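/- **Setting.** For a bounded set $K$ let $\Delta(K)$ denote its diameter. A polytope $K$ is *$\delta$-well-separated* if every vertex $v$ of $K$ has distance at least $\delta\Delta(K)$ from the convex hull of the other vertices. An *$\mathrm{opt}_\varepsilon(K)$ oracle* for a convex set $K$ in a Euclidean space is a map $x$ that assigns to every unit vector $u$ a point $x(u)$ with $\mathrm{dist}(x(u),K)\le \varepsilon\Delta(K)$ and $u\cdot x(u)\ge \max_{y\in K}u\cdot y-\varepsilon\Delta(K)$. *Latent polytope model.* Let $k\ge 2$, $n\ge 1$, and let $K\subseteq\mathbb R^d$ be a polytope with exactly $k$ vertices $M_1,\dots,M_k$. Let $P,A\in\mathbb R^{d\times n}$ have columns $P_j$ (latent points, all in $K$) and $A_j$ (data, arbitrary), and put $\sigma_0=\|P-A\|/\sqrt n$ (spectral norm). Let $w_0>0$ be such that for every $\ell\in\{1,\dots,k\}$ $$\bigl|\{j:\ |P_j-M_\ell|\le \sigma_0/\sqrt{w_0}\}\bigr|\ \ge\ w_0 n .$$ Let $V$ be a $k$-dimensional SVD subspace of $A$, i.e. the span of left singular vectors of $A$ for its $k$ largest singular values (so $k\le d$), and let $\widehat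 K,\widehat A_j\in V$ be the orthogonal projections of $K$, $A_j$ to $V$. *Subset smoothing.* For a positive integer $r$, the answer to a unit query $u\in V$ is $x(u)=\frac1r\sum_{j\in R}\widehat A_j$, where $R=R(u)$ is a set of $r$ indices with the $r$ highest values of $u\cdot\widehat A_j$ (ties broken arbitrarily). *The $k$OLP algorithm* (parameters $\delta,c_0,m$ and the oracle $x$). Draw independent random unit vectors $u_1,\dots,u_m\in V$ (normalized standard Gaussian vectors of $V$) and let $W=\{x(u_1),\dots,x(u_m)\}$. Put $\varepsilon'=32\delta^2/\sqrt{c_0}$ and $\varepsilon_3=4\sqrt{\varepsilon'}$. Let $Q''$ be the set of those $w\in W$ which are not within distance $\varepsilon'\Delta(W)$ of the convex hull of $\{y\in W:\ |w-y|\ge \varepsilon_3\Delta(W)\}$ (no point is within any distance of the empty set). Output any inclusion-maximal $Q\subseteq Q''$ whose points have pairwise distances $>2\varepsilon_3\Delta(W)$. **Theorem.** There are absolute constants $C_0,C>0$ such that the following holds for every $c_0\ge C_0$. In the latent polytope model above, suppose that $K$ is $\delta$-well-separated, where $$\frac{\sqrt{\log k}}{\sqrt{c_0k}}\le\delta\le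 1\qquad\text{and}\qquad \sigma_0\le\frac{\delta^2\Delta(K)}{100\,c_0}\cdot\frac{\sqrt{w_0}}{\sqrt k}.$$ Let $r$ be any integer with $w_0n/2\le r\le\lceil w_0n\rceil$ (for instance $w_0n$ rounded to an integer). Then subset smoothing with this $r$ can be carried out for every unit query $u \in V$, and for every way of breaking ties: 1. Subset smoothing is an $\mathrm{opt}_{\varepsilon}(\widehat K)$ oracle in $V$ with $\varepsilon=\dfrac{10\,\sigma_0}{\sqrt{w_0}\,\Delta(K)}$. 2. For every $\eta\in(0,1)$ and every integer $m\ge k^{C/\delta^2}\log(k/\eta)$, with probability at least $1-\eta$ over $u_1,\dots,u_m$ the following is true: the $k$OLP algorithm run with this oracle has an output, and every possible output $Q\subseteq W$ has exactly $k$ points and contains, for every vertex $v$ of $K$, a point $v'$ with $|v-v'|\le\delta\Delta(K)/5$. -/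

import Mathlib

open MeasureTheory ProbabilityTheory Set
open scoped RealInnerProductSpace

noncomputable section

namespace LatentPolytope

/-- `K` is the polytope whose (pairwise distinct) vertices are `M 0, …, M (k-1)`. -/
structure IsPolytopeWithVertices {E : Type*} [NormedAddCommGroup E] [InnerProductSpace ℝ E]
    {k : ℕ} (K : Set E) (M : Fin k → E) : Prop where
  injective : Function.Injective M
  eq_convexHull : K = convexHull ℝ (range M)
  extremePoints_eq : K.extremePoints ℝ = range M

/-- Every vertex of `K` is at distance at least `δ * diam K` from the convex hull of the other
vertices. -/
def WellSeparated {E : Type*} [NormedAddCommGroup E] [InnerProductSpace ℝ E]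
    (δ : ℝ) (K : Set E) : Prop :=
  ∀ v ∈ K.extremePoints ℝ, ∀ y ∈ convexHull ℝ (K.extremePoints ℝ \ {v}),
    δ * Metric.diam K ≤ dist v y

/-- `x` is an optimization oracle with error `ε` for `K`. -/
def IsOptOracle {E : Type*} [NormedAddCommGroup E] [InnerProductSpace ℝ E]
    (ε : ℝ) (K : Set E) (x : E → E) : Prop :=
  ∀ u : E, ‖u‖ = 1 →
    (∃ y ∈ K, dist (x u) y ≤ ε * Metric.diam K) ∧
    ∀ y ∈ K, ⟪u, y⟫ - ε * Metric.diam K ≤ ⟪u, x u⟫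

/-- The `j`-th column of a matrix, as a point of Euclidean space. -/
def col {d n : ℕ} (B : Matrix (Fin d) (Fin n) ℝ) (j : Fin n) : EuclideanSpace ℝ (Fin d) :=
  WithLp.toLp 2 fun i => B i j

/-- The spectral norm of a matrix (operator norm between Euclidean spaces). -/
def spectralNorm {d n : ℕ} (B : Matrix (Fin d) (Fin n) ℝ) : ℝ :=
  ‖LinearMap.toContinuousLinearMap (Matrix.toEuclideanLin B)‖

/-- `σ₀ = ‖P - A‖ / √n`. -/
def sigma0 {d n : ℕ} (P A : Matrix (Fin d) (Fin n) ℝ) : ℝ :=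
  spectralNorm (P - A) / √(n : ℝ)

/-- `V` is a `k`-dimensional SVD subspace of `A`: it is spanned by left singular vectors
`b 0, …, b (k-1)` of `A` that belong to the `k` largest singular values. -/
def IsSVDSubspace {d n : ℕ} (A : Matrix (Fin d) (Fin n) ℝ) (k : ℕ)
    (V : Submodule ℝ (EuclideanSpace ℝ (Fin d))) : Prop :=
  k ≤ d ∧
  ∃ (b : OrthonormalBasis (Fin d) ℝ (EuclideanSpace ℝ (Fin d))) (s : Fin d → ℝ),
    Antitone s ∧ (∀ i, 0 ≤ s i) ∧
    (∀ i, Matrix.toEuclideanLin (A * A.transpose) (b i) = s i ^ 2 • b i) ∧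
    V = Submodule.span ℝ (b '' {i : Fin d | (i : ℕ) < k})

/-- The `j`-th data point, projected orthogonally to `V`. -/
def projCol {d n : ℕ} (A : Matrix (Fin d) (Fin n) ℝ)
    (V : Submodule ℝ (EuclideanSpace ℝ (Fin d))) (j : Fin n) : V :=
  V.orthogonalProjectionOnto (col A j)

/-- The projection of the set `K` to `V`. -/
def projSet {d : ℕ} (V : Submodule ℝ (EuclideanSpace ℝ (Fin d)))
    (K : Set (EuclideanSpace ℝ (Fin d))) : Set V :=
  (fun x => V.orthogonalProjectionOnto x) '' K

/-- `x` answers each unit query `u ∈ V` by the subset smoothing algorithm: the answer is the mean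
of `r` projected data points with the `r` highest values of `⟪u, ·⟫` (ties broken arbitrarily). -/
def IsSubsetSmoothing {d n : ℕ} (A : Matrix (Fin d) (Fin n) ℝ)
    (V : Submodule ℝ (EuclideanSpace ℝ (Fin d))) (r : ℕ) (x : V → V) : Prop :=
  ∀ u : V, ‖u‖ = 1 → ∃ R : Finset (Fin n), R.card = r ∧
    (∀ i ∈ R, ∀ j ∉ R, ⟪u, projCol A V j⟫ ≤ ⟪u, projCol A V i⟫) ∧
    x u = (r : ℝ)⁻¹ • ∑ j ∈ R, projCol A V j

/-- The `ε`-convex hull of `S`, relative to the finite set `W ⊇ S`. -/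
def softHull {E : Type*} [NormedAddCommGroup E] [InnerProductSpace ℝ E]
    (ε : ℝ) (W S : Set E) : Set E :=
  {x | ∃ y ∈ convexHull ℝ S, dist x y ≤ ε * Metric.diam W}

/-- The points of `W` that are not in the `ε`-convex hull of the points of `W` at distance at
least `ε₃ * diam W` from them. -/
def softExtreme {E : Type*} [NormedAddCommGroup E] [InnerProductSpace ℝ E]
    (ε ε₃ : ℝ) (W : Set E) : Set E :=
  {w ∈ W | w ∉ softHull ε W {x ∈ W | ε₃ * Metric.diam W ≤ dist w x}}

/-- `Q` is a possible output of the soft convex hull procedure on `W`: an inclusion-maximal set of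
points of `softExtreme ε ε₃ W` with pairwise distances larger than `2 * ε₃ * diam W`. -/
def IsSoftHullOutput {E : Type*} [NormedAddCommGroup E] [InnerProductSpace ℝ E]
    (ε ε₃ : ℝ) (W Q : Set E) : Prop :=
  Maximal (fun S : Set E => S ⊆ softExtreme ε ε₃ W ∧
    S.Pairwise fun x y => 2 * ε₃ * Metric.diam W < dist x y) Q

/-- The law of a random unit vector: a standard Gaussian vector, normalized. -/
def randomUnit (E : Type*) [NormedAddCommGroup E] [InnerProductSpace ℝ E]
    [FiniteDimensional ℝ E] [MeasurableSpace E] : Measure E :=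
  (stdGaussian E).map fun g => ‖g‖⁻¹ • g

theorem isProbabilityMeasure_randomUnit (E : Type*) [NormedAddCommGroup E]
    [InnerProductSpace ℝ E] [FiniteDimensional ℝ E] [MeasurableSpace E] [BorelSpace E] :
    IsProbabilityMeasure (randomUnit E) :=
  Measure.isProbabilityMeasure_map
    ((measurable_norm.inv).smul measurable_id).aemeasurable

/-- `Q` is a possible output of the k-OLP algorithm when it uses the oracle `x` and the query
vectors `u 0, …, u (m-1)`: the soft convex hull procedure, with parameters
`ε = 32 δ² / √c₀` and `ε₃ = 4 √ε`, is run on the set of the answers. -/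
def IsKOLPOutput {E : Type*} [NormedAddCommGroup E] [InnerProductSpace ℝ E] {m : ℕ}
    (δ c₀ : ℝ) (x : E → E) (u : Fin m → E) (Q : Set E) : Prop :=
  IsSoftHullOutput (32 * δ ^ 2 / √c₀) (4 * √(32 * δ ^ 2 / √c₀))
    (range fun i => x (u i)) Q

end LatentPolytope

end

/-! Write `τ = σ₀/√w₀` and `D = diam K`. Averaging tames spectral noise: over any set of at least `c
n` indices, the means of the `P_j` and of the `A_j` differ by at most `σ₀/√c`
(`norm_mean_col_sub_le`). The columns of `P` span at most `k` dimensions, so the singular values of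
`A` beyond the `k`-th are at most `‖P - A‖`, and means of data points are also close to `V`. Hence
every vertex is within `3τ` of `V` (`norm_starProjection_orthogonal_vertex_le`), and the projected
vertices `a l` stay separated by almost `δD`. The same averaging bound gives subset smoothing the
absolute error `e = 3τ` (`IsSubsetSmoothing.oracle`).

For each vertex a unit vector `q` separates `a l` from the other `a j` by `9/10 δD`. A Gaussian
vector of `V` has component at least `10 √(log k)/δ` along `q` with probability `k^(-O(1/δ²))`. The
part orthogonal to `q` is independent of this component and typically harmless: its products with
all `a l - a j` are at most `3 √(log k) D` in absolute value, and its norm is at most `2√k`. After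
normalization `a l` wins by a gap `g` of order `D/√(c₀k)` (`rpow_le_randomUnit_gapDirections`), so
the oracle's answer is within `e + 2eD/g = O(δ²D/√c₀)` of `a l` (`dist_le_of_mem_gapDirections`). A
union bound over the vertices makes all of them hit.

The soft hull then works by comparison of two scales. An answer far from all vertex approximations
is almost in their hull, hence discarded. An answer near a vertex is cut off by `q` from all points
at distance `ε₃ diam W`, with a margin of order `δ² D c₀^(-1/4)` that dominates the tolerance of
order `δ² D c₀^(-1/2)`. So the soft extreme points form one cluster per vertex, and a maximal
separated set takes exactly one point from each (`softHullOutput_spec`). -/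

namespace LatentPolytope

/-! ### Standard Gaussian vectors: tails, independence, a lower bound for a large component. -/

section Gaussian

variable {E : Type*} [NormedAddCommGroup E] [InnerProductSpace ℝ E] [FiniteDimensional ℝ E]
  [MeasurableSpace E] [BorelSpace E]

theorem map_inner_stdGaussian (v : E) :
    (stdGaussian E).map (fun g => ⟪v, g⟫) = gaussianReal 0 (‖v‖₊ ^ 2) := by
  have h := IsGaussian.map_eq_gaussianReal (μ := stdGaussian E) (innerSL ℝ v)
  have h1 : (fun g : E => ⟪v, g⟫) = innerSL ℝ v := by ext; simp
  rw [h1, h, integral_strongDual_stdGaussian, variance_dual_stdGaussian]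
  congr 1
  ext
  simp

/-- A larger variance proxy is still a valid one, so a single `D` serves a whole family of vectors.
-/
theorem hasSubgaussianMGF_inner_stdGaussian {v : E} {D : NNReal} (hv : ‖v‖₊ ≤ D) :
    HasSubgaussianMGF (fun g : E => ⟪v, g⟫) (D ^ 2) (stdGaussian E) := by
  have hm : Measurable (fun g : E => ⟪v, g⟫) := by fun_prop
  have h : HasSubgaussianMGF id (D ^ 2) ((stdGaussian E).map (fun g : E => ⟪v, g⟫)) := by
    rw [map_inner_stdGaussian]
    refine ⟨fun t => ?_, fun t => ?_⟩
    · exact integrable_exp_mul_gaussianReal t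
    · rw [mgf_id_gaussianReal]
      refine Real.exp_le_exp.2 ?_
      have : (‖v‖₊ : ℝ) ^ 2 ≤ (D : ℝ) ^ 2 := by
        gcongr
      push_cast at this ⊢
      nlinarith [sq_nonneg t]
  simpa [Function.comp_def] using h.of_map hm.aemeasurable

theorem stdGaussian_real_abs_inner_gt_le {v : E} {D lam : ℝ} (hD : 0 < D) (hlam : 0 ≤ lam)
    (hv : ‖v‖ ≤ D) :
    (stdGaussian E).real {g | lam * D < |⟪v, g⟫|} ≤ 2 * Real.exp (-lam ^ 2 / 2) := by
  lift D to NNReal using hD.le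
  have h1 := (hasSubgaussianMGF_inner_stdGaussian (E := E) (v := v) (D := D)
    (by exact_mod_cast hv)).measure_ge_le (ε := lam * D) (by positivity)
  have h2 := (hasSubgaussianMGF_inner_stdGaussian (E := E) (v := -v) (D := D)
    (by rw [nnnorm_neg]; exact_mod_cast hv)).measure_ge_le (ε := lam * D) (by positivity)
  have e : -(lam * (D : ℝ)) ^ 2 / (2 * ((D ^ 2 : NNReal) : ℝ)) = -lam ^ 2 / 2 := by
    push_cast
    field_simp
  rw [e] at h1 h2
  have hsub : {g : E | lam * D < |⟪v, g⟫|} ⊆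
      {g | lam * D ≤ ⟪v, g⟫} ∪ {g | lam * D ≤ ⟪-v, g⟫} := by
    intro g hg
    have hg' : lam * D < |⟪v, g⟫| := hg
    rcases lt_abs.1 hg' with h | h
    · exact Or.inl h.le
    · right
      simpa [inner_neg_left] using h.le
  calc _ ≤ _ := measureReal_mono hsub
    _ ≤ _ := measureReal_union_le _ _
    _ ≤ _ := by linarith

theorem integral_inner_sq_stdGaussian (v : E) :
    ∫ g, ⟪v, g⟫ ^ 2 ∂(stdGaussian E) = ‖v‖ ^ 2 := by
  have hm : Measurable (fun g : E => ⟪v, g⟫) := by fun_prop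
  have h : ∫ y, y ^ 2 ∂((stdGaussian E).map (fun g => ⟪v, g⟫)) =
      ∫ g, ⟪v, g⟫ ^ 2 ∂(stdGaussian E) :=
    integral_map hm.aemeasurable (by fun_prop)
  rw [← h, map_inner_stdGaussian]
  have := variance_id_gaussianReal (μ := 0) (v := ‖v‖₊ ^ 2)
  rw [variance_eq_integral (by fun_prop)] at this
  simpa using this

theorem integrable_inner_sq_stdGaussian (v : E) :
    Integrable (fun g => ⟪v, g⟫ ^ 2) (stdGaussian E) := by
  have : MemLp (fun g : E => ⟪v, g⟫) 2 (stdGaussian E) := by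
    simpa using (IsGaussian.memLp_dual (stdGaussian E) (innerSL ℝ v) 2 (by simp))
  exact this.integrable_sq

/-- Markov's inequality for `‖g‖²`, whose expectation is the dimension. -/
theorem stdGaussian_real_norm_gt_le {R : ℝ} (hR : 0 < R)
    (hd : 4 * (Module.finrank ℝ E : ℝ) ≤ R ^ 2) :
    (stdGaussian E).real {g | R < ‖g‖} ≤ 1 / 4 := by
  let b := stdOrthonormalBasis ℝ E
  have hn : ∀ g : E, ‖g‖ ^ 2 = ∑ i, ⟪b i, g⟫ ^ 2 := fun g => by
    rw [← b.sum_sq_norm_inner_right g]; simp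
  have hint : Integrable (fun g : E => ‖g‖ ^ 2) (stdGaussian E) := by
    simp_rw [hn]
    exact integrable_finsetSum _ fun i _ => integrable_inner_sq_stdGaussian _
  have hval : ∫ g, ‖g‖ ^ 2 ∂(stdGaussian E) = Module.finrank ℝ E := by
    simp_rw [hn]
    rw [integral_finsetSum _ fun i _ => integrable_inner_sq_stdGaussian _]
    simp [integral_inner_sq_stdGaussian]
  have hM := mul_meas_ge_le_integral_of_nonneg (μ := stdGaussian E)
    (f := fun g : E => ‖g‖ ^ 2) (Filter.Eventually.of_forall fun g => by positivity) hint (R ^ 2)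
  rw [hval] at hM
  have hsub : {g : E | R < ‖g‖} ⊆ {g | R ^ 2 ≤ ‖g‖ ^ 2} := fun g hg => by
    have : R < ‖g‖ := hg
    exact pow_le_pow_left₀ hR.le this.le 2
  have h2 := measureReal_mono (μ := stdGaussian E) hsub
  have hR2 : 0 < R ^ 2 := by positivity
  have h3 : R ^ 2 * (stdGaussian E).real {g : E | R < ‖g‖} ≤ R ^ 2 * (1 / 4) := by
    calc _ ≤ R ^ 2 * (stdGaussian E).real {g : E | R ^ 2 ≤ ‖g‖ ^ 2} := by gcongr
      _ ≤ _ := hM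
      _ ≤ _ := by linarith
  exact le_of_mul_le_mul_left h3 hR2

/-- The two parts are jointly Gaussian and uncorrelated, hence independent. -/
theorem indepFun_inner_sub_stdGaussian {q : E} (hq : ‖q‖ = 1) :
    IndepFun (fun g : E => ⟪q, g⟫) (fun g : E => g - ⟪q, g⟫ • q) (stdGaussian E) := by
  have hX : HasGaussianLaw (fun g : E => (⟪q, g⟫, g - ⟪q, g⟫ • q)) (stdGaussian E) := by
    have h0 : HasGaussianLaw (id : E → E) (stdGaussian E) := 
      ⟨by rw [Measure.map_id]; infer_instance⟩
    have := h0.map ((innerSL ℝ q).prod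
      (ContinuousLinearMap.id ℝ E - (innerSL ℝ q).smulRight q))
    exact this
  refine hX.indepFun_of_covariance_inner fun x y => ?_
  have h1 : (fun g : E => ⟪x, ⟪q, g⟫⟫) = fun g => ⟪x • q, g⟫ := by
    ext g; simp [inner_smul_left, mul_comm]
  have h2 : (fun g : E => ⟪y, g - ⟪q, g⟫ • q⟫) = fun g => ⟪y - ⟪y, q⟫ • q, g⟫ := by
    ext g; simp [inner_sub_left, inner_sub_right, inner_smul_left, inner_smul_right, mul_comm]
  rw [h1, h2, ← covarianceBilin_apply_eq_cov IsGaussian.memLp_two_id, covarianceBilin_stdGaussian]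
  rw [innerSL_apply_apply, inner_smul_left, inner_sub_right, inner_smul_right,
    real_inner_self_eq_norm_sq, hq, real_inner_comm q y]
  simp

theorem exp_le_gaussianReal_Icc {T : ℝ} (hT : 0 ≤ T) :
    Real.exp (-1 - (T + 1) ^ 2 / 2) ≤ (gaussianReal 0 1).real (Icc T (T + 1)) := by
  have hone : (1 : NNReal) ≠ 0 := one_ne_zero
  rw [measureReal_def, gaussianReal_apply_eq_integral _ hone,
    ENNReal.toReal_ofReal (setIntegral_nonneg measurableSet_Icc
      fun x _ => gaussianPDFReal_nonneg _ _ _)]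
  have hle : ∀ y ∈ Icc T (T + 1), Real.exp (-1 - (T + 1) ^ 2 / 2) ≤ gaussianPDFReal 0 1 y := by
    intro y hy
    rw [gaussianPDFReal, sub_eq_add_neg, Real.exp_add]
    -- The term `-1` in the exponent absorbs the normalizing factor, since `2π ≤ e²`. The interval
    -- has length 1, so bounding the density by its value at the right end suffices.
    have hpi : Real.exp (-1) ≤ (√(2 * Real.pi * ((1 : NNReal) : ℝ)))⁻¹ := by
      rw [Real.exp_neg]
      refine inv_anti₀ (by positivity) ?_
      rw [Real.sqrt_le_left (Real.exp_pos 1).le]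
      have := Real.exp_one_gt_d9
      have := Real.pi_lt_d2
      push_cast
      nlinarith
    refine mul_le_mul hpi (Real.exp_le_exp.2 ?_) (Real.exp_pos _).le (by positivity)
    push_cast
    have := pow_le_pow_left₀ (hT.trans hy.1) hy.2 2
    nlinarith
  have := setIntegral_mono_on (μ := volume) (s := Icc T (T + 1))
    (f := fun _ => Real.exp (-1 - (T + 1) ^ 2 / 2)) (integrable_const _)
    ((integrable_gaussianPDFReal 0 1).integrableOn) measurableSet_Icc hle
  simpa using this

/-- A standard Gaussian vector has a prescribed large component along `q` while the orthogonal
component stays moderate, with a probability that is not too small. -/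
theorem exp_le_stdGaussian_real {ι : Type*} [Fintype ι] {q : E} (hq : ‖q‖ = 1) {T R D lam : ℝ}
    (hT : 0 ≤ T) (hR : 0 < R) (hd : 4 * (Module.finrank ℝ E : ℝ) ≤ R ^ 2) (hD : 0 < D)
    (hlam : 0 ≤ lam) {v : ι → E} (hv : ∀ i, ‖v i‖ ≤ D)
    (hcard : Fintype.card ι * (2 * Real.exp (-lam ^ 2 / 2)) ≤ 1 / 4) :
    Real.exp (-1 - (T + 1) ^ 2 / 2) / 2 ≤
      (stdGaussian E).real {g | ⟪q, g⟫ ∈ Icc T (T + 1) ∧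
        ‖g - ⟪q, g⟫ • q‖ ≤ R ∧ ∀ i, |⟪v i, g - ⟪q, g⟫ • q⟫| ≤ lam * D} := by
  set B : Set E := {y | ‖y‖ ≤ R ∧ ∀ i, |⟪v i, y⟫| ≤ lam * D} with hB
  have hBm : MeasurableSet B := by
    rw [hB, ofPred_and, ofPred_forall]
    refine (measurableSet_le (by fun_prop) (by fun_prop)).inter
      (MeasurableSet.iInter fun i => measurableSet_le (by fun_prop) (by fun_prop))
  have hproj : ∀ g : E, ‖g - ⟪q, g⟫ • q‖ ≤ ‖g‖ := fun g => by
    refine le_of_sq_le_sq ?_ (norm_nonneg _)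
    rw [@norm_sub_sq_real, norm_smul, hq, inner_smul_right, real_inner_comm]
    simp only [Real.norm_eq_abs, mul_one, sq_abs]
    nlinarith [sq_nonneg ⟪q, g⟫]
  have hinner : ∀ w g : E, ⟪w, g - ⟪q, g⟫ • q⟫ = ⟪w - ⟪q, w⟫ • q, g⟫ := fun w g => by
    simp [inner_sub_left, inner_sub_right, inner_smul_left, inner_smul_right, mul_comm,
      real_inner_comm]
  -- The failure probability is at most 1/4 from the norm plus 1/4 from the union bound over `i`.
  -- Moving the projection onto `v i` by `hinner` only shortens that vector.
  have hYB : 1 / 2 ≤ (stdGaussian E).real ((fun g : E => g - ⟪q, g⟫ • q) ⁻¹' B) := by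
    have hcompl : ((fun g : E => g - ⟪q, g⟫ • q) ⁻¹' B)ᶜ ⊆
        {g | R < ‖g‖} ∪ ⋃ i ∈ (Finset.univ : Finset ι), {g | lam * D < |⟪v i - ⟪q, v i⟫ • q, g⟫|} := by
      intro g hg
      simp only [hB, mem_compl_iff, mem_preimage, mem_ofPred_eq, not_and_or, not_forall,
        not_le] at hg
      rcases hg with h | ⟨i, hi⟩
      · exact Or.inl (h.trans_le (hproj g))
      · right
        simp only [mem_iUnion]
        exact ⟨i, Finset.mem_univ _, by rw [hinner] at hi; exact hi⟩
    have h1 : (stdGaussian E).real ((fun g : E => g - ⟪q, g⟫ • q) ⁻¹' B)ᶜ ≤ 1 / 2 := by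
      calc _ ≤ _ := measureReal_mono hcompl
        _ ≤ _ := measureReal_union_le _ _
        _ ≤ 1 / 4 + ∑ i : ι, 2 * Real.exp (-lam ^ 2 / 2) := by
          refine add_le_add (stdGaussian_real_norm_gt_le hR hd)
            ((measureReal_biUnion_finset_le _ _).trans (Finset.sum_le_sum fun i _ => ?_))
          exact stdGaussian_real_abs_inner_gt_le hD hlam ((hproj _).trans (hv i))
        _ ≤ _ := by
          rw [Finset.sum_const, nsmul_eq_mul, Finset.card_univ]
          linarith
    rw [probReal_compl_eq_one_sub (hBm.preimage (by fun_prop))] at h1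
    linarith
  have hX : Real.exp (-1 - (T + 1) ^ 2 / 2) ≤
      (stdGaussian E).real ((fun g : E => ⟪q, g⟫) ⁻¹' Icc T (T + 1)) := by
    rw [← map_measureReal_apply (by fun_prop) measurableSet_Icc, map_inner_stdGaussian]
    have : ‖q‖₊ = 1 := by ext; simpa using hq
    rw [this]
    simpa using exp_le_gaussianReal_Icc hT
  have hind := (indepFun_inner_sub_stdGaussian hq).measure_inter_preimage_eq_mul _ _
    (measurableSet_Icc (a := T) (b := T + 1)) hBm
  have hind' : (stdGaussian E).real
      ((fun g : E => ⟪q, g⟫) ⁻¹' Icc T (T + 1) ∩ (fun g : E => g - ⟪q, g⟫ • q) ⁻¹' B) =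
      (stdGaussian E).real ((fun g : E => ⟪q, g⟫) ⁻¹' Icc T (T + 1)) *
      (stdGaussian E).real ((fun g : E => g - ⟪q, g⟫ • q) ⁻¹' B) := by
    rw [measureReal_def, hind, ENNReal.toReal_mul]
    rfl
  calc _ = Real.exp (-1 - (T + 1) ^ 2 / 2) * (1 / 2) := by ring
    _ ≤ _ := mul_le_mul hX hYB (by norm_num) measureReal_nonneg
    _ = _ := hind'.symm
    _ = _ := rfl

theorem stdGaussian_singleton_zero [Nontrivial E] : stdGaussian E {0} = 0 := by
  obtain ⟨v, hv⟩ := exists_ne (0 : E)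
  have h : (stdGaussian E).map (fun g => ⟪v, g⟫) {0} = 0 := by
    rw [map_inner_stdGaussian]
    have : (‖v‖₊ ^ 2) ≠ 0 := by simpa using hv
    have := nullSingletonClass_gaussianReal (μ := 0) this
    exact measure_singleton 0
  rw [Measure.map_apply (by fun_prop) (measurableSet_singleton _)] at h
  refine measure_mono_null ?_ h
  rintro _ rfl
  simp

/-- Normalization fails only at the origin, a null set. The oracle guarantees concern unit queries
only, so this is needed before they apply. -/
theorem ae_norm_eq_one_randomUnit [Nontrivial E] : ∀ᵐ u ∂(randomUnit E), ‖u‖ = 1 := by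
  rw [randomUnit, ae_map_iff (by fun_prop) (measurableSet_eq_fun (by fun_prop) (by fun_prop))]
  filter_upwards [compl_mem_ae_iff.2 (stdGaussian_singleton_zero (E := E))] with g hg
  have : ‖g‖ ≠ 0 := by simpa using hg
  rw [norm_smul, norm_inv, norm_norm, inv_mul_cancel₀ this]

end Gaussian

/-! ### Spectral perturbation: data means and vertices are close to the SVD subspace. -/

section Spectral

variable {d n k : ℕ}

theorem toEuclideanLin_norm_le (B : Matrix (Fin d) (Fin n) ℝ) (z : EuclideanSpace ℝ (Fin n)) :
    ‖Matrix.toEuclideanLin B z‖ ≤ spectralNorm B * ‖z‖ :=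
  (LinearMap.toContinuousLinearMap (Matrix.toEuclideanLin B)).le_opNorm z

theorem spectralNorm_nonneg (B : Matrix (Fin d) (Fin n) ℝ) : 0 ≤ spectralNorm B :=
  norm_nonneg _

theorem sigma0_nonneg (P A : Matrix (Fin d) (Fin n) ℝ) : 0 ≤ sigma0 P A :=
  div_nonneg (spectralNorm_nonneg _) (Real.sqrt_nonneg _)

theorem toEuclideanLin_eq_sum_col (B : Matrix (Fin d) (Fin n) ℝ) (z : EuclideanSpace ℝ (Fin n)) :
    Matrix.toEuclideanLin B z = ∑ j, z j • col B j := by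
  ext i
  simp [Matrix.toLpLin_apply, Matrix.mulVec, dotProduct, col, mul_comm]

theorem col_sub (P A : Matrix (Fin d) (Fin n) ℝ) (j : Fin n) :
    col (P - A) j = col P j - col A j := by
  ext i
  simp [col]

/-- The indicator vector of a finset of coordinates. -/
def indicatorVec (S : Finset (Fin n)) : EuclideanSpace ℝ (Fin n) :=
  WithLp.toLp 2 fun j => if j ∈ S then 1 else 0

theorem norm_indicatorVec (S : Finset (Fin n)) : ‖indicatorVec S‖ = √(S.card : ℝ) := by
  rw [EuclideanSpace.norm_eq]
  simp [indicatorVec]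

theorem toEuclideanLin_indicatorVec (B : Matrix (Fin d) (Fin n) ℝ) (S : Finset (Fin n)) :
    Matrix.toEuclideanLin B (indicatorVec S) = ∑ j ∈ S, col B j := by
  rw [toEuclideanLin_eq_sum_col]
  simp [indicatorVec]

/-- If `S` has at least `c n` elements, then a map that is bounded by `‖P - A‖` sends the
normalized indicator vector of `S` to a vector of length at most `σ₀ / √c`. -/
theorem inv_card_mul_le {P A : Matrix (Fin d) (Fin n) ℝ} {S : Finset (Fin n)} {c : ℝ}
    (hn : 0 < n) (hc : 0 < c) (hS : c * n ≤ S.card) :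
    (S.card : ℝ)⁻¹ * (spectralNorm (P - A) * ‖indicatorVec S‖) ≤ sigma0 P A / √c := by
  have hn' : (0 : ℝ) < n := by exact_mod_cast hn
  have hS0 : (0 : ℝ) < S.card := lt_of_lt_of_le (by positivity) hS
  have h1 : √c * √(n : ℝ) ≤ √(S.card : ℝ) := by
    rw [← Real.sqrt_mul hc.le]
    exact Real.sqrt_le_sqrt hS
  have h2 : (S.card : ℝ)⁻¹ * (spectralNorm (P - A) * ‖indicatorVec S‖) =
      spectralNorm (P - A) / √(S.card : ℝ) := by
    rw [norm_indicatorVec]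
    have := Real.mul_self_sqrt hS0.le
    have h3 : 0 < √(S.card : ℝ) := Real.sqrt_pos.2 hS0
    field_simp
    rw [sq, this, mul_comm]
  rw [h2, sigma0, div_div, mul_comm (√(n : ℝ))]
  exact div_le_div_of_nonneg_left (spectralNorm_nonneg _) (by positivity) h1

theorem norm_mean_col_sub_le {P A : Matrix (Fin d) (Fin n) ℝ} {S : Finset (Fin n)} {c : ℝ}
    (hn : 0 < n) (hc : 0 < c) (hS : c * n ≤ S.card) :
    ‖(S.card : ℝ)⁻¹ • ∑ j ∈ S, col P j - (S.card : ℝ)⁻¹ • ∑ j ∈ S, col A j‖ ≤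
      sigma0 P A / √c := by
  refine le_trans ?_ (inv_card_mul_le hn hc hS)
  rw [← smul_sub, ← Finset.sum_sub_distrib, norm_smul, norm_inv, Real.norm_natCast]
  simp_rw [← col_sub]
  rw [← toEuclideanLin_indicatorVec]
  gcongr
  exact toEuclideanLin_norm_le _ _

/-- The left side is the quadratic form of `A Aᵀ`, which is diagonal in the basis `b`. -/
theorem norm_sq_adjoint_eq_sum {A : Matrix (Fin d) (Fin n) ℝ}
    (b : OrthonormalBasis (Fin d) ℝ (EuclideanSpace ℝ (Fin d))) {s : Fin d → ℝ}
    (hA : ∀ i, Matrix.toEuclideanLin (A * A.transpose) (b i) = s i ^ 2 • b i)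
    (y : EuclideanSpace ℝ (Fin d)) :
    ‖(Matrix.toEuclideanLin A).adjoint y‖ ^ 2 = ∑ i, s i ^ 2 * ⟪b i, y⟫ ^ 2 := by
  have hcomp : ∀ x, Matrix.toEuclideanLin (A * A.transpose) x =
      Matrix.toEuclideanLin A ((Matrix.toEuclideanLin A).adjoint x) := fun x => by
    rw [← Matrix.toEuclideanLin_conjTranspose_eq_adjoint, Matrix.conjTranspose_eq_transpose_of_trivial]
    ext i
    simp [Matrix.toLpLin_apply, Matrix.mulVec_mulVec]
  rw [← real_inner_self_eq_norm_sq, LinearMap.adjoint_inner_left, ← hcomp]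
  conv_lhs => rw [← b.sum_repr' y, map_sum, sum_inner]
  refine Finset.sum_congr rfl fun i _ => ?_
  simp_rw [map_smul, hA]
  rw [inner_smul_left, inner_sum, Finset.sum_eq_single i]
  · simp [inner_smul_right, b.norm_eq_one]
    ring
  · intro j _ hj
    simp [inner_smul_right, b.inner_eq_zero hj.symm]
  · simp

theorem norm_adjoint_le (B : Matrix (Fin d) (Fin n) ℝ) (y : EuclideanSpace ℝ (Fin d)) :
    ‖(Matrix.toEuclideanLin B).adjoint y‖ ≤ spectralNorm B * ‖y‖ := by
  have h1 := real_inner_self_eq_norm_sq ((Matrix.toEuclideanLin B).adjoint y)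
  rw [LinearMap.adjoint_inner_left] at h1
  have h2 := real_inner_le_norm y (Matrix.toEuclideanLin B ((Matrix.toEuclideanLin B).adjoint y))
  have h3 := mul_le_mul_of_nonneg_left
    (toEuclideanLin_norm_le B ((Matrix.toEuclideanLin B).adjoint y)) (norm_nonneg y)
  rcases (norm_nonneg ((Matrix.toEuclideanLin B).adjoint y)).eq_or_lt with h | h
  · rw [← h]
    exact mul_nonneg (spectralNorm_nonneg _) (norm_nonneg _)
  · refine le_of_mul_le_mul_right ?_ h
    nlinarith

theorem adjoint_apply_eq_zero {P : Matrix (Fin d) (Fin n) ℝ} {y : EuclideanSpace ℝ (Fin d)}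
    (h : ∀ j, ⟪col P j, y⟫ = 0) : (Matrix.toEuclideanLin P).adjoint y = 0 := by
  refine ext_inner_left ℝ fun z => ?_
  rw [LinearMap.adjoint_inner_right, toEuclideanLin_eq_sum_col, sum_inner]
  simp [inner_smul_left, h]

/-- The `k`-th singular value (counted from `0`) of `A` is at most the distance from `A` to a
matrix whose columns lie in a subspace of dimension at most `k`. -/
theorem singularValue_le {P A : Matrix (Fin d) (Fin n) ℝ}
    {U : Submodule ℝ (EuclideanSpace ℝ (Fin d))} (hU : Module.finrank ℝ U ≤ k)
    (hP : ∀ j, col P j ∈ U)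
    (b : OrthonormalBasis (Fin d) ℝ (EuclideanSpace ℝ (Fin d))) {s : Fin d → ℝ}
    (hs : Antitone s) (hs0 : ∀ i, 0 ≤ s i)
    (hA : ∀ i, Matrix.toEuclideanLin (A * A.transpose) (b i) = s i ^ 2 • b i)
    {i₀ : Fin d} (hi₀ : k ≤ i₀) : s i₀ ≤ spectralNorm (P - A) := by
  let e : Fin (i₀ + 1) → Fin d := Fin.castLE i₀.2
  have he : Function.Injective e := Fin.castLE_injective _
  have hlin : LinearIndependent ℝ (fun i => b (e i)) := b.orthonormal.linearIndependent.comp e he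
  have hdim : Module.finrank ℝ U < Module.finrank ℝ (Submodule.span ℝ (range fun i => b (e i))) := by
    rw [finrank_span_eq_card hlin, Fintype.card_fin]
    omega
  -- Courant–Fischer argument: the first `i₀ + 1 > k` singular vectors span a space too large to
  -- project injectively to `U`. It contains some `y ≠ 0` orthogonal to `U`, on which `Pᵀ` vanishes
  -- while `Aᵀ` stretches by at least `s i₀`.
  obtain ⟨⟨y, hy⟩, hyker, hy0⟩ := Submodule.exists_mem_ne_zero_of_ne_bot
    (LinearMap.ker_ne_bot_of_finrank_lt
      (f := (U.orthogonalProjectionOnto.toLinearMap ∘ₗ Submodule.subtype _)) hdim)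
  have hyU : ∀ j, ⟪col P j, y⟫ = 0 := fun j => by
    have h1 : U.orthogonalProjectionOnto y = 0 := by simpa using hyker
    rw [Submodule.orthogonalProjectionOnto_eq_zero_iff] at h1
    exact (Submodule.mem_orthogonal _ _).1 h1 _ (hP j)
  have hy0' : 0 < ‖y‖ := norm_pos_iff.2 fun h => hy0 (Subtype.ext h)
  have hcoef : ∀ i, i₀ < i → ⟪b i, y⟫ = 0 := fun i hi => by
    have hle : Submodule.span ℝ (range fun i => b (e i)) ≤ (ℝ ∙ b i)ᗮ := by
      rw [Submodule.span_le]
      rintro _ ⟨j, rfl⟩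
      refine Submodule.mem_orthogonal_singleton_iff_inner_right.2 (b.inner_eq_zero ?_)
      rintro rfl
      have := j.2
      simp only [e, Fin.lt_def, Fin.val_castLE] at hi
      omega
    exact Submodule.mem_orthogonal_singleton_iff_inner_right.1 (hle hy)
  have h1 : s i₀ ^ 2 * ‖y‖ ^ 2 ≤ ‖(Matrix.toEuclideanLin A).adjoint y‖ ^ 2 := by
    rw [norm_sq_adjoint_eq_sum b hA, ← b.sum_sq_inner_right y, Finset.mul_sum]
    refine Finset.sum_le_sum fun i _ => ?_
    rcases lt_or_ge i₀ i with hi | hi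
    · simp [hcoef i hi]
    · have := hs hi
      gcongr
      exact hs0 _
  have h2 : ‖(Matrix.toEuclideanLin A).adjoint y‖ ≤ spectralNorm (P - A) * ‖y‖ := by
    refine le_trans (le_of_eq ?_) (norm_adjoint_le _ _)
    rw [map_sub, map_sub, LinearMap.sub_apply, adjoint_apply_eq_zero hyU, zero_sub, norm_neg]
  have h3 : (s i₀ * ‖y‖) ^ 2 ≤ (spectralNorm (P - A) * ‖y‖) ^ 2 := by
    rw [mul_pow]
    exact h1.trans (pow_le_pow_left₀ (norm_nonneg _) h2 2)
  have h4 := abs_le_of_sq_le_sq h3 (mul_nonneg (spectralNorm_nonneg _) (norm_nonneg _))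
  exact le_of_mul_le_mul_right ((le_abs_self _).trans h4) hy0'

/-- The image of `A` is close to its SVD subspace. -/
theorem norm_starProjection_orthogonal_le {P A : Matrix (Fin d) (Fin n) ℝ}
    {U V : Submodule ℝ (EuclideanSpace ℝ (Fin d))} (hU : Module.finrank ℝ U ≤ k)
    (hP : ∀ j, col P j ∈ U) (hV : IsSVDSubspace A k V) (z : EuclideanSpace ℝ (Fin n)) :
    ‖Vᗮ.starProjection (Matrix.toEuclideanLin A z)‖ ≤ spectralNorm (P - A) * ‖z‖ := by
  obtain ⟨-, b, s, hs, hs0, hA, rfl⟩ := hV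
  set V := Submodule.span ℝ (b '' {i : Fin d | (i : ℕ) < k})
  set w := Vᗮ.starProjection (Matrix.toEuclideanLin A z) with hw
  have hwV : w ∈ Vᗮ := Submodule.starProjection_apply_mem _ _
  -- On `Vᗮ` only the singular values of index at least `k` contribute.
  have h1 : ‖(Matrix.toEuclideanLin A).adjoint w‖ ^ 2 ≤ spectralNorm (P - A) ^ 2 * ‖w‖ ^ 2 := by
    rw [norm_sq_adjoint_eq_sum b hA, ← b.sum_sq_inner_right w, Finset.mul_sum]
    refine Finset.sum_le_sum fun i _ => ?_
    rcases lt_or_ge (i : ℕ) k with hi | hi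
    · have : ⟪b i, w⟫ = 0 :=
        (Submodule.mem_orthogonal _ _).1 hwV _ (Submodule.subset_span ⟨i, hi, rfl⟩)
      simp [this]
    · gcongr
      · exact hs0 _
      · exact singularValue_le hU hP b hs hs0 hA hi
  have h2 : ‖(Matrix.toEuclideanLin A).adjoint w‖ ≤ spectralNorm (P - A) * ‖w‖ := by
    rw [← mul_pow] at h1
    exact le_of_sq_le_sq h1 (mul_nonneg (spectralNorm_nonneg _) (norm_nonneg _))
  -- Duality carries the bound for `Aᵀ` on `Vᗮ` over to the `Vᗮ`-part of `A z`.
  have h3 : ‖w‖ ^ 2 = ⟪(Matrix.toEuclideanLin A).adjoint w, z⟫ := by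
    rw [LinearMap.adjoint_inner_left, ← real_inner_self_eq_norm_sq]
    have := Submodule.starProjection_inner_eq_zero (K := Vᗮ) (Matrix.toEuclideanLin A z) w hwV
    rw [inner_sub_left, sub_eq_zero] at this
    rw [← hw] at this
    rw [← this, real_inner_comm]
  have h4 := real_inner_le_norm ((Matrix.toEuclideanLin A).adjoint w) z
  have h5 := mul_le_mul_of_nonneg_right h2 (norm_nonneg z)
  rcases (norm_nonneg w).eq_or_lt with h | h
  · rw [← h]
    exact mul_nonneg (spectralNorm_nonneg _) (norm_nonneg _)
  · refine le_of_mul_le_mul_right ?_ h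
    nlinarith

/-- The points of the polytope are close to the SVD subspace, at the vertices. -/
theorem norm_starProjection_orthogonal_vertex_le {K : Set (EuclideanSpace ℝ (Fin d))}
    {M : Fin k → EuclideanSpace ℝ (Fin d)} {P A : Matrix (Fin d) (Fin n) ℝ} {w₀ : ℝ}
    {V : Submodule ℝ (EuclideanSpace ℝ (Fin d))} (hn : 0 < n) (hw₀ : 0 < w₀)
    (hK : K = convexHull ℝ (range M)) (hP : ∀ j, col P j ∈ K) (hV : IsSVDSubspace A k V)
    {l : Fin k} {S : Finset (Fin n)} (hS : w₀ * n ≤ S.card)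
    (hSl : ∀ j ∈ S, ‖col P j - M l‖ ≤ sigma0 P A / √w₀) :
    ‖Vᗮ.starProjection (M l)‖ ≤ 3 * (sigma0 P A / √w₀) := by
  have hn' : (0 : ℝ) < n := by exact_mod_cast hn
  have hS0 : (0 : ℝ) < S.card := lt_of_lt_of_le (by positivity) hS
  have hU : Module.finrank ℝ (Submodule.span ℝ (range M)) ≤ k := by
    simpa [Set.finrank] using finrank_range_le_card (R := ℝ) M
  have hKU : ∀ j, col P j ∈ Submodule.span ℝ (range M) := fun j => by
    have := hP j
    rw [hK] at this
    exact convexHull_min Submodule.subset_span (Submodule.convex _) this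
  have h1 : ‖Vᗮ.starProjection ((S.card : ℝ)⁻¹ • ∑ j ∈ S, col A j)‖ ≤ sigma0 P A / √w₀ := by
    refine le_trans ?_ (inv_card_mul_le hn hw₀ hS)
    rw [map_smul, norm_smul, norm_inv, Real.norm_natCast, ← toEuclideanLin_indicatorVec]
    gcongr
    exact norm_starProjection_orthogonal_le hU hKU hV _
  have h2 := norm_mean_col_sub_le (P := P) (A := A) hn hw₀ hS
  have h3 : ‖M l - (S.card : ℝ)⁻¹ • ∑ j ∈ S, col P j‖ ≤ sigma0 P A / √w₀ := by
    have : M l - (S.card : ℝ)⁻¹ • ∑ j ∈ S, col P j =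
        (S.card : ℝ)⁻¹ • ∑ j ∈ S, (M l - col P j) := by
      rw [Finset.sum_sub_distrib, smul_sub, Finset.sum_const, ← Nat.cast_smul_eq_nsmul ℝ,
        smul_smul, inv_mul_cancel₀ hS0.ne', one_smul]
    rw [this, norm_smul, norm_inv, Real.norm_natCast, inv_mul_le_iff₀ hS0, ← nsmul_eq_mul]
    refine (norm_sum_le _ _).trans (Finset.sum_le_card_nsmul _ _ _ fun j hj => ?_)
    rw [norm_sub_rev]
    exact hSl j hj
  have h4 : ‖M l - (S.card : ℝ)⁻¹ • ∑ j ∈ S, col A j‖ ≤ 2 * (sigma0 P A / √w₀) := by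
    calc _ ≤ _ := norm_sub_le_norm_sub_add_norm_sub _ ((S.card : ℝ)⁻¹ • ∑ j ∈ S, col P j) _
      _ ≤ _ := by linarith
  -- Three equal errors add up: vertex to mean of `P`, mean of `P` to mean of `A`, mean of `A` to
  -- `V`.
  calc ‖Vᗮ.starProjection (M l)‖ = ‖Vᗮ.starProjection (M l - (S.card : ℝ)⁻¹ • ∑ j ∈ S, col A j) +
        Vᗮ.starProjection ((S.card : ℝ)⁻¹ • ∑ j ∈ S, col A j)‖ := by rw [map_sub, sub_add_cancel]
    _ ≤ _ := norm_add_le _ _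
    _ ≤ 2 * (sigma0 P A / √w₀) + sigma0 P A / √w₀ :=
      add_le_add ((Submodule.norm_starProjection_apply_le _ _).trans h4) h1
    _ = _ := by ring

end Spectral

/-! ### Subsets carrying the largest values. -/

section TopSubset

theorem exists_card_eq_forall_le {ι : Type*} [Fintype ι] [DecidableEq ι] (f : ι → ℝ) {r : ℕ}
    (hr : r ≤ Fintype.card ι) :
    ∃ R : Finset ι, R.card = r ∧ ∀ i ∈ R, ∀ j ∉ R, f j ≤ f i := by
  induction r with
  | zero => exact ⟨∅, by simp⟩
  | succ r ih =>
    obtain ⟨R, hR, hf⟩ := ih (Nat.le_of_succ_le hr)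
    have hne : Rᶜ.Nonempty := by
      rw [← Finset.card_pos, Finset.card_compl]
      omega
    obtain ⟨a, ha, hmax⟩ := Finset.exists_max_image Rᶜ f hne
    have ha' : a ∉ R := Finset.mem_compl.1 ha
    refine ⟨insert a R, by rw [Finset.card_insert_of_notMem ha', hR], fun i hi j hj => ?_⟩
    rw [Finset.mem_insert, not_or] at hj
    rcases Finset.mem_insert.1 hi with rfl | hi
    · exact hmax j (Finset.mem_compl.2 hj.2)
    · exact hf i hi j hj.2

/-- Exchange argument: `S \ R` and `R \ S` have equal size, and every value on the former is at most
every value on the latter. -/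
theorem sum_le_sum_of_forall_le {ι : Type*} [DecidableEq ι] {f : ι → ℝ} {R S : Finset ι}
    (hcard : S.card = R.card) (hf : ∀ i ∈ R, ∀ j ∉ R, f j ≤ f i) :
    ∑ i ∈ S, f i ≤ ∑ i ∈ R, f i := by
  rw [← Finset.sum_inter_add_sum_sdiff S R, ← Finset.sum_inter_add_sum_sdiff R S,
    Finset.inter_comm R S]
  refine add_le_add_right ?_ _
  have hc : (S \ R).card = (R \ S).card := by
    have h1 := Finset.card_sdiff_add_card_inter S R
    have h2 := Finset.card_sdiff_add_card_inter R S
    rw [Finset.inter_comm] at h2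
    omega
  rcases (S \ R).eq_empty_or_nonempty with h | h
  · rw [h, Finset.card_empty, eq_comm, Finset.card_eq_zero] at hc
    rw [h, hc]
  · obtain ⟨a, ha, hmax⟩ := Finset.exists_max_image _ f h
    calc _ ≤ (S \ R).card • f a := Finset.sum_le_card_nsmul _ _ _ hmax
      _ = (R \ S).card • f a := by rw [hc]
      _ ≤ _ := Finset.card_nsmul_le_sum _ _ _ fun i hi =>
        hf i (Finset.mem_sdiff.1 hi).1 a (Finset.mem_sdiff.1 ha).2

end TopSubset

/-! ### Subset smoothing as an optimization oracle. -/

section Smoothing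

variable {d n k : ℕ}

theorem exists_isSubsetSmoothing (A : Matrix (Fin d) (Fin n) ℝ)
    (V : Submodule ℝ (EuclideanSpace ℝ (Fin d))) {r : ℕ} (hr : r ≤ n) :
    ∃ x : V → V, IsSubsetSmoothing A V r x := by
  choose R hR hf using fun u : V =>
    exists_card_eq_forall_le (fun j : Fin n => ⟪u, projCol A V j⟫) (r := r) (by simpa using hr)
  exact ⟨fun u => (r : ℝ)⁻¹ • ∑ j ∈ R u, projCol A V j, fun u _ => ⟨R u, hR u, hf u, rfl⟩⟩

/-- Subset smoothing answers queries with an absolute error of `3 σ₀ / √w₀`. -/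
theorem IsSubsetSmoothing.oracle {K : Set (EuclideanSpace ℝ (Fin d))}
    {M : Fin k → EuclideanSpace ℝ (Fin d)} {P A : Matrix (Fin d) (Fin n) ℝ} {w₀ : ℝ}
    {V : Submodule ℝ (EuclideanSpace ℝ (Fin d))} (hn : 0 < n) (hw₀ : 0 < w₀)
    (hK : K = convexHull ℝ (range M)) (hP : ∀ j, col P j ∈ K)
    {S : Fin k → Finset (Fin n)} (hS : ∀ l, w₀ * n ≤ (S l).card)
    (hSl : ∀ l, ∀ j ∈ S l, ‖col P j - M l‖ ≤ sigma0 P A / √w₀)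
    {r : ℕ} (hr : w₀ * n / 2 ≤ r) (hr' : r ≤ ⌈w₀ * n⌉₊) {x : V → V}
    (hx : IsSubsetSmoothing A V r x) {u : V} (hu : ‖u‖ = 1) :
    (∃ y ∈ projSet V K, dist (x u) y ≤ 3 * (sigma0 P A / √w₀)) ∧
      ∀ y ∈ projSet V K, ⟪u, y⟫ - 3 * (sigma0 P A / √w₀) ≤ ⟪u, x u⟫ := by
  set τ := sigma0 P A / √w₀ with hτ
  have hτ0 : 0 ≤ τ := div_nonneg (sigma0_nonneg _ _) (Real.sqrt_nonneg _)
  have hn' : (0 : ℝ) < n := by exact_mod_cast hn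
  have hr0 : (0 : ℝ) < r := lt_of_lt_of_le (by positivity) hr
  have hsmul : ∀ y : V, ⟪u, (r : ℝ)⁻¹ • y⟫ = (r : ℝ)⁻¹ * ⟪u, y⟫ := fun y =>
    real_inner_smul_right u y _
  -- Only `r ≥ w₀ n / 2` is known, so averaging costs a factor `√2`, rounded up to 2.
  have hτ2 : sigma0 P A / √(w₀ / 2) ≤ 2 * τ := by
    have h1 : √w₀ ≤ 2 * √(w₀ / 2) := by
      rw [Real.sqrt_le_left (by positivity), mul_pow, Real.sq_sqrt (by positivity)]
      linarith
    have h2 : 0 < √w₀ := Real.sqrt_pos.2 hw₀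
    have h3 : 0 < √(w₀ / 2) := Real.sqrt_pos.2 (by positivity)
    rw [hτ, ← mul_div_assoc, div_le_div_iff₀ h3 h2]
    nlinarith [sigma0_nonneg P A]
  have hmean : ∀ T : Finset (Fin n), T.card = r →
      ‖(r : ℝ)⁻¹ • ∑ j ∈ T, projCol P V j - (r : ℝ)⁻¹ • ∑ j ∈ T, projCol A V j‖ ≤ 2 * τ := by
    intro T hT
    have h1 := norm_mean_col_sub_le (P := P) (A := A) (S := T) (c := w₀ / 2) hn (by positivity)
      (by rw [hT]; linarith)
    rw [hT] at h1
    refine le_trans ?_ (h1.trans hτ2)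
    refine le_trans (le_of_eq ?_) (V.norm_orthogonalProjectionOnto_apply_le _)
    simp only [map_sub, map_smul, map_sum, projCol]
  obtain ⟨R, hR, hf, hxu⟩ := hx u hu
  refine ⟨⟨(r : ℝ)⁻¹ • ∑ j ∈ R, projCol P V j, ⟨(r : ℝ)⁻¹ • ∑ j ∈ R, col P j, ?_, ?_⟩, ?_⟩, ?_⟩
  · rw [Finset.smul_sum]
    have hKc : Convex ℝ K := hK ▸ convex_convexHull ℝ _
    refine hKc.sum_mem (fun _ _ => by positivity) ?_ fun j _ => hP j
    rw [Finset.sum_const, hR, nsmul_eq_mul, mul_inv_cancel₀ hr0.ne']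
  · simp only [map_smul, map_sum, projCol]
  · rw [hxu, dist_comm, dist_eq_norm]
    linarith [hmean R hR]
  · have hvert : ∀ l, ⟪u, V.orthogonalProjectionOnto (M l)⟫ - 3 * τ ≤ ⟪u, x u⟫ := fun l => by
      -- Rounding `w₀ n` up is harmless because the cardinality is an integer. So some `r` latent
      -- points all lie near `M l`, and the chosen top `r` data points score at least as well as
      -- theirs.
      have hrS : r ≤ (S l).card := hr'.trans (Nat.ceil_le.2 (hS l))
      obtain ⟨T, hTS, hT⟩ := Finset.exists_subset_card_eq hrS
      have h1 := sum_le_sum_of_forall_le (hT.trans hR.symm) hf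
      rw [← inner_sum, ← inner_sum] at h1
      have h2 : ⟪u, (r : ℝ)⁻¹ • ∑ j ∈ T, projCol A V j⟫ ≤ ⟪u, x u⟫ := by
        rw [hxu, hsmul, hsmul]
        gcongr
      have h3 := real_inner_le_norm u
        ((r : ℝ)⁻¹ • ∑ j ∈ T, projCol P V j - (r : ℝ)⁻¹ • ∑ j ∈ T, projCol A V j)
      rw [hu, one_mul, inner_sub_right] at h3
      have h4 : ⟪u, V.orthogonalProjectionOnto (M l)⟫ - τ ≤
          ⟪u, (r : ℝ)⁻¹ • ∑ j ∈ T, projCol P V j⟫ := by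
        rw [hsmul, inner_sum, le_inv_mul_iff₀ hr0, ← hT, ← nsmul_eq_mul]
        refine Finset.card_nsmul_le_sum _ _ _ fun j hj => ?_
        have h5 := real_inner_le_norm u (V.orthogonalProjectionOnto (M l - col P j))
        rw [hu, one_mul, map_sub, inner_sub_right] at h5
        have h6 := V.norm_orthogonalProjectionOnto_apply_le (M l - col P j)
        rw [map_sub, norm_sub_rev (M l)] at h6
        have := hSl l j (hTS hj)
        simp only [projCol]
        linarith
      linarith [hmean T hT]
    rintro _ ⟨p, hp, rfl⟩
    rw [hK] at hp
    -- The bound is linear in the point of `K`, so it passes from the vertices to the hull.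
    have hhalf : convexHull ℝ (range M) ⊆
        {p | ⟪u, V.orthogonalProjectionOnto p⟫ ≤ ⟪u, x u⟫ + 3 * τ} := by
      refine convexHull_min ?_ (convex_halfSpace_le
        (((innerSL ℝ u).comp V.orthogonalProjectionOnto).toLinearMap.isLinear) _)
      rintro _ ⟨l, rfl⟩
      have := hvert l
      change ⟪u, V.orthogonalProjectionOnto (M l)⟫ ≤ ⟪u, x u⟫ + 3 * τ
      linarith
    have : ⟪u, V.orthogonalProjectionOnto p⟫ ≤ ⟪u, x u⟫ + 3 * τ := hhalf hp
    linarith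

end Smoothing

/-! ### Deterministic analysis of the soft convex hull. -/

section SoftHull

variable {E : Type*} [NormedAddCommGroup E] [InnerProductSpace ℝ E]

/-- If `q` separates `a` from the other points of `S` by a gap proportional to `s`, then the same
conic estimate holds on the whole convex hull of `S`. -/
theorem mul_dist_le_inner_of_mem_convexHull {S : Set E} {a q : E} {s : ℝ} (hs : 0 ≤ s)
    (h : ∀ z ∈ S, s * dist z a ≤ ⟪q, a - z⟫) {y : E} (hy : y ∈ convexHull ℝ S) :
    s * dist y a ≤ ⟪q, a - y⟫ := by
  have hconv : Convex ℝ {y : E | s * dist y a ≤ ⟪q, a - y⟫} := by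
    have h1 : ConvexOn ℝ univ (fun y : E => s * dist y a) := by
      simpa using (convexOn_dist a convex_univ).smul hs
    have h2 : ConcaveOn ℝ univ (fun y : E => ⟪q, a - y⟫) := by
      refine ⟨convex_univ, fun x _ y _ α β _ _ hαβ => le_of_eq ?_⟩
      simp only [inner_sub_right, inner_add_right, inner_smul_right, smul_eq_mul]
      linear_combination (⟪q, a⟫) * hαβ
    simpa [sub_nonpos] using (h1.sub h2).convex_le 0
  exact convexHull_min h hconv hy

theorem subset_of_isSoftHullOutput {ε ε₃ : ℝ} {W Q : Set E} (h : IsSoftHullOutput ε ε₃ W Q) :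
    Q ⊆ W := fun _ hw => (h.prop.1 hw).1

theorem exists_isSoftHullOutput {ε ε₃ : ℝ} {W : Set E} (hW : W.Finite) :
    ∃ Q, IsSoftHullOutput ε ε₃ W Q := by
  have hfin : {S : Set E | S ⊆ softExtreme ε ε₃ W ∧
      S.Pairwise fun x y => 2 * ε₃ * Metric.diam W < dist x y}.Finite :=
    hW.finite_subsets.subset fun S hS => hS.1.trans fun _ hw => hw.1
  obtain ⟨Q, hQ⟩ := hfin.exists_maximal ⟨∅, empty_subset _, pairwise_empty _⟩
  exact ⟨Q, hQ⟩

variable {k : ℕ} {a : Fin k → E} {w : Fin k → E} {W : Set E} {ε ε₃ ρ σ : ℝ}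

open scoped Pointwise in
/-- A soft extreme point is near one of the points `w l` that approximate the vertices. -/
theorem exists_dist_lt_of_mem_softExtreme
    (hWa : ∀ x ∈ W, ∃ y ∈ convexHull ℝ (range a), dist x y ≤ ρ)
    (hw : ∀ l, w l ∈ W) (hwa : ∀ l, dist (w l) (a l) ≤ ρ)
    (hε : 2 * ρ ≤ ε * Metric.diam W) {x : E} (hx : x ∈ softExtreme ε ε₃ W) :
    ∃ l, dist x (w l) < ε₃ * Metric.diam W := by
  by_contra! hcon
  refine hx.2 ?_
  set S : Set E := {y ∈ W | ε₃ * Metric.diam W ≤ dist x y}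
  have hS : ∀ l, w l ∈ S := fun l => ⟨hw l, hcon l⟩
  -- If `x` were far from every `w l`, all of them would lie in `S`, whose hull would then reach
  -- within `ρ` of the whole polytope and within `2ρ` of `x`.
  have hsub : convexHull ℝ (range a) ⊆ convexHull ℝ S + Metric.closedBall (0 : E) ρ := by
    refine convexHull_min ?_ ((convex_convexHull ℝ S).add (convex_closedBall _ _))
    rintro _ ⟨l, rfl⟩
    refine ⟨w l, subset_convexHull ℝ S (hS l), a l - w l, ?_, by simp⟩
    rw [mem_closedBall_zero_iff, ← dist_eq_norm, dist_comm]
    exact hwa l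
  obtain ⟨y, hy, hxy⟩ := hWa x hx.1
  obtain ⟨z, hz, b, hb, rfl⟩ := hsub hy
  refine ⟨z, hz, le_trans ?_ hε⟩
  rw [mem_closedBall_zero_iff] at hb
  calc dist x z ≤ dist x (z + b) + dist (z + b) z := dist_triangle _ _ _
    _ ≤ ρ + ρ := add_le_add hxy (by simpa [dist_eq_norm] using hb)
    _ = 2 * ρ := by ring

/-- A point of `W` near a vertex is soft extreme. -/
theorem mem_softExtreme_of_dist_le
    (hWa : ∀ x ∈ W, ∃ y ∈ convexHull ℝ (range a), dist x y ≤ ρ) (hσ : 0 ≤ σ) {l : Fin k} {q : E}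
    (hq : ‖q‖ ≤ 1) (hsep : ∀ j, σ * dist (a j) (a l) ≤ ⟪q, a l - a j⟫)
    {x : E} (hx : x ∈ W) (hxa : dist x (a l) ≤ ρ)
    (hε : ε * Metric.diam W < σ * (ε₃ * Metric.diam W - 2 * ρ) - 2 * ρ) :
    x ∈ softExtreme ε ε₃ W := by
  refine ⟨hx, ?_⟩
  rintro ⟨z, hz, hxz⟩
  have hρ : ∀ c : E, |⟪q, c⟫| ≤ ‖c‖ := fun c =>
    (abs_real_inner_le_norm q c).trans (mul_le_of_le_one_left (norm_nonneg _) hq)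
  set g := σ * (ε₃ * Metric.diam W - 2 * ρ) - ρ with hg
  -- Points of `W` far from `x` are near polytope points far from `a l`, and by the conic estimate
  -- `q` is smaller there in proportion to the distance. The gap `g` survives convex combinations.
  have hhalf : convexHull ℝ {y ∈ W | ε₃ * Metric.diam W ≤ dist x y} ⊆
      {y | ⟪q, y⟫ ≤ ⟪q, a l⟫ - g} := by
    refine convexHull_min ?_ (convex_halfSpace_le
      (innerSL ℝ q).toLinearMap.isLinear _)
    rintro y ⟨hyW, hxy⟩
    obtain ⟨y', hy', hyy'⟩ := hWa y hyW
    have h1 := mul_dist_le_inner_of_mem_convexHull (q := q) hσ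
      (by rintro _ ⟨j, rfl⟩; exact hsep j) hy'
    have h2 : ε₃ * Metric.diam W - 2 * ρ ≤ dist y' (a l) := by
      have := dist_triangle4 x (a l) y' y
      rw [dist_comm (a l) y', dist_comm y' y] at this
      linarith
    have h3 := mul_le_mul_of_nonneg_left h2 hσ
    have h4 := (abs_le.1 (hρ (y - y'))).2
    rw [← dist_eq_norm, inner_sub_right] at h4
    rw [inner_sub_right] at h1
    change ⟪q, y⟫ ≤ ⟪q, a l⟫ - g
    linarith
  have h5 : ⟪q, z⟫ ≤ ⟪q, a l⟫ - g := hhalf hz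
  have h6 := (abs_le.1 (hρ (a l - x))).2
  have h7 := (abs_le.1 (hρ (x - z))).2
  rw [← dist_eq_norm, inner_sub_right] at h6 h7
  rw [dist_comm] at h6
  linarith

/-- Assigning to each point of `Q` a nearby `w l` is a bijection onto the vertices. Two points with
the same label would violate the pairwise distances of `Q`; a label never used would allow `w l` to
be added to `Q`, contrary to maximality. -/
theorem softHullOutput_spec
    (hWa : ∀ x ∈ W, ∃ y ∈ convexHull ℝ (range a), dist x y ≤ ρ)
    (hWv : ∀ l, ∃ x ∈ W, dist x (a l) ≤ ρ) (hσ : 0 ≤ σ)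
    (hsep : ∀ l, ∃ q : E, ‖q‖ ≤ 1 ∧ ∀ j, σ * dist (a j) (a l) ≤ ⟪q, a l - a j⟫)
    (hε : 2 * ρ ≤ ε * Metric.diam W)
    (hε' : ε * Metric.diam W < σ * (ε₃ * Metric.diam W - 2 * ρ) - 2 * ρ)
    (hdist : ∀ i j, i ≠ j → 4 * (ε₃ * Metric.diam W) + 2 * ρ ≤ dist (a i) (a j))
    (hpos : 0 < ε₃ * Metric.diam W)
    {Q : Set E} (hQ : IsSoftHullOutput ε ε₃ W Q) :
    Q.ncard = k ∧ ∀ l, ∃ x ∈ Q, dist x (a l) ≤ ε₃ * Metric.diam W + ρ := by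
  choose w hw hwa using hWv
  have hext : ∀ l, w l ∈ softExtreme ε ε₃ W := fun l => by
    obtain ⟨q, hq, hs⟩ := hsep l
    exact mem_softExtreme_of_dist_le hWa hσ hq hs (hw l) (hwa l) hε'
  have hnear : ∀ x : Q, ∃ l, dist (x : E) (w l) < ε₃ * Metric.diam W := fun x =>
    exists_dist_lt_of_mem_softExtreme hWa hw hwa hε (hQ.prop.1 x.2)
  have hww : ∀ i j, i ≠ j → 4 * (ε₃ * Metric.diam W) ≤ dist (w i) (w j) := fun i j hij => by
    have := dist_triangle4 (a i) (w i) (w j) (a j)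
    rw [dist_comm (a i) (w i)] at this
    linarith [hdist i j hij, hwa i, hwa j]
  choose f hf using hnear
  have hinj : Function.Injective f := fun x y hxy => by
    by_contra hne
    have h1 := hQ.prop.2 x.2 y.2 fun h => hne (Subtype.ext h)
    have h2 := dist_triangle_right (x : E) y (w (f x))
    have h3 := hf y
    rw [← hxy] at h3
    linarith [hf x]
  have hsurj : Function.Surjective f := fun l => by
    by_contra! hcon
    have hfar : ∀ x ∈ Q, 2 * ε₃ * Metric.diam W < dist x (w l) := fun x hx => by
      have h1 := hww _ _ (hcon ⟨x, hx⟩)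
      have h2 := hf ⟨x, hx⟩
      have h3 := dist_triangle_left (w (f ⟨x, hx⟩)) (w l) x
      simp only at h2
      linarith
    have hmem : w l ∈ Q := by
      refine hQ.le_of_ge (y := insert (w l) Q) ⟨?_, ?_⟩ (subset_insert _ _) (mem_insert _ _)
      · exact insert_subset (hext l) hQ.prop.1
      · refine hQ.prop.2.insert fun x hx _ => ?_
        have := hfar x hx
        exact ⟨by rwa [dist_comm], this⟩
    have := hfar _ hmem
    rw [dist_self] at this
    linarith
  refine ⟨?_, fun l => ?_⟩
  · rw [← Nat.card_coe_set_eq, Nat.card_eq_of_bijective f ⟨hinj, hsurj⟩, Nat.card_fin]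
  · obtain ⟨x, rfl⟩ := hsurj l
    refine ⟨x, x.2, ?_⟩
    have := dist_triangle (x : E) (w (f x)) (a (f x))
    linarith [hf x, hwa (f x)]

end SoftHull

/-! ### Random queries: every vertex is a clear maximizer for some query. -/

section Queries

/-- Union bound: each of the `k` sets is missed with probability at most `(1 - p)^m ≤ exp (-p m) ≤ η
/ k`. -/
theorem pi_forall_notMem_le {Ω : Type*} [MeasurableSpace Ω] (μ : Measure Ω)
    [IsProbabilityMeasure μ] {k m : ℕ} (hk : 0 < k) {G : Fin k → Set Ω}
    (hG : ∀ l, MeasurableSet (G l)) {p η : ℝ} (hp : ∀ l, p ≤ μ.real (G l)) (hη : 0 < η)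
    (hm : Real.log (k / η) ≤ p * m) :
    Measure.pi (fun _ : Fin m => μ) {u | ∃ l, ∀ i, u i ∉ G l} ≤ ENNReal.ofReal η := by
  have hk' : (0 : ℝ) < k := by exact_mod_cast hk
  have hone : ∀ l, (Measure.pi (fun _ : Fin m => μ)).real (univ.pi fun _ => (G l)ᶜ) ≤ η / k := by
    intro l
    rw [measureReal_def, Measure.pi_pi, Finset.prod_const, Finset.card_univ, Fintype.card_fin,
      ENNReal.toReal_pow, ← measureReal_def, probReal_compl_eq_one_sub (hG l)]
    have h0 : μ.real (G l) ≤ 1 := measureReal_le_one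
    have h1 : 1 - μ.real (G l) ≤ Real.exp (-p) :=
      (by linarith [hp l] : _ ≤ -p + 1).trans (Real.add_one_le_exp _)
    calc (1 - μ.real (G l)) ^ m ≤ Real.exp (-p) ^ m := pow_le_pow_left₀ (by linarith) h1 m
      _ = Real.exp (-(p * m)) := by rw [← Real.exp_nat_mul]; ring_nf
      _ ≤ Real.exp (-Real.log (k / η)) := Real.exp_le_exp.2 (by linarith)
      _ = η / k := by rw [Real.exp_neg, Real.exp_log (by positivity), inv_div]
  have hsub : {u : Fin m → Ω | ∃ l, ∀ i, u i ∉ G l} ⊆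
      ⋃ l ∈ (Finset.univ : Finset (Fin k)), univ.pi fun _ => (G l)ᶜ := by
    rintro u ⟨l, hl⟩
    simp only [mem_iUnion]
    exact ⟨l, Finset.mem_univ _, fun i _ => hl i⟩
  rw [ENNReal.le_ofReal_iff_toReal_le (measure_ne_top _ _) hη.le, ← measureReal_def]
  calc _ ≤ _ := measureReal_mono hsub (measure_ne_top _ _)
    _ ≤ _ := measureReal_biUnion_finset_le _ _
    _ ≤ ∑ _l : Fin k, η / k := Finset.sum_le_sum fun l _ => hone l
    _ = η := by
      rw [Finset.sum_const, Finset.card_univ, Fintype.card_fin, nsmul_eq_mul]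
      field_simp

variable {E : Type*} [NormedAddCommGroup E] [InnerProductSpace ℝ E] {k : ℕ}

/-- The unit vectors `u` for which `a l` maximizes `⟪u, ·⟫` over the points `a j` with a gap. -/
def gapDirections (a : Fin k → E) (g : ℝ) (l : Fin k) : Set E :=
  {u | ‖u‖ = 1 ∧ ∀ j, j ≠ l → g ≤ ⟪u, a l - a j⟫}

theorem measurableSet_gapDirections [MeasurableSpace E] [BorelSpace E] (a : Fin k → E) (g : ℝ)
    (l : Fin k) : MeasurableSet (gapDirections a g l) := by
  refine IsClosed.measurableSet ?_
  have : gapDirections a g l =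
      {u | ‖u‖ = 1} ∩ ⋂ j, ⋂ _ : j ≠ l, {u | g ≤ ⟪u, a l - a j⟫} := by
    ext u
    simp [gapDirections]
  rw [this]
  exact (isClosed_eq (by fun_prop) (by fun_prop)).inter (isClosed_iInter fun j =>
    isClosed_iInter fun _ => isClosed_le (by fun_prop) (by fun_prop))

/-- The polytope point `y` near the answer loses at most `2e` against `a l` in direction `u`,
whereas moving away from `a l` costs at least `g / D` per unit of distance. -/
theorem dist_le_of_mem_gapDirections {a : Fin k → E} {D g e : ℝ} (hD : 0 < D) (hg : 0 < g)
    (ha : ∀ i j, dist (a i) (a j) ≤ D) {l : Fin k} {u z : E} (hu : u ∈ gapDirections a g l)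
    (h1 : ∃ y ∈ convexHull ℝ (range a), dist z y ≤ e)
    (h2 : ∀ y ∈ convexHull ℝ (range a), ⟪u, y⟫ - e ≤ ⟪u, z⟫) :
    dist z (a l) ≤ e + 2 * e * D / g := by
  obtain ⟨y, hy, hzy⟩ := h1
  have h3 : g / D * dist y (a l) ≤ ⟪u, a l - y⟫ := by
    refine mul_dist_le_inner_of_mem_convexHull (by positivity) ?_ hy
    rintro _ ⟨j, rfl⟩
    rcases eq_or_ne j l with rfl | hj
    · simp
    · refine le_trans ?_ (hu.2 j hj)
      rw [div_mul_eq_mul_div, div_le_iff₀ hD]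
      exact mul_le_mul_of_nonneg_left (ha _ _) hg.le
  have h4 := h2 (a l) (subset_convexHull ℝ _ (mem_range_self l))
  have h5 := real_inner_le_norm u (z - y)
  rw [hu.1, one_mul, inner_sub_right, ← dist_eq_norm] at h5
  rw [inner_sub_right] at h3
  have h6 : dist y (a l) ≤ 2 * e * D / g := by
    rw [le_div_iff₀ hg]
    have : g / D * dist y (a l) ≤ 2 * e := by linarith
    rw [div_mul_eq_mul_div, div_le_iff₀ hD] at this
    linarith
  linarith [dist_triangle z y (a l)]

/-- The component along `q` contributes at least `T s` to each gap, the orthogonal part removes at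
most `lam D`, and normalization divides by at most `T + 1 + R`. -/
theorem exp_le_randomUnit_gapDirections [FiniteDimensional ℝ E] [MeasurableSpace E]
    [BorelSpace E] {a : Fin k → E} {D g s T R lam : ℝ} (hD : 0 < D)
    (ha : ∀ i j, dist (a i) (a j) ≤ D) {l : Fin k} {q : E} (hq : ‖q‖ = 1)
    (hs : ∀ j, j ≠ l → s ≤ ⟪q, a l - a j⟫) (hT : 0 < T) (hR : 0 < R)
    (hd : 4 * (Module.finrank ℝ E : ℝ) ≤ R ^ 2) (hlam : 0 ≤ lam)
    (hcard : k * (2 * Real.exp (-lam ^ 2 / 2)) ≤ 1 / 4) (hg : 0 ≤ g) (hs0 : 0 ≤ s)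
    (hgs : g * (T + 1 + R) ≤ T * s - lam * D) :
    Real.exp (-1 - (T + 1) ^ 2 / 2) / 2 ≤ (randomUnit E).real (gapDirections a g l) := by
  refine (exp_le_stdGaussian_real hq hT.le hR hd hD hlam (v := fun j => a l - a j)
    (fun j => by rw [← dist_eq_norm]; exact ha _ _) (by simpa using hcard)).trans ?_
  rw [randomUnit, map_measureReal_apply (by fun_prop) (measurableSet_gapDirections _ _ _)]
  refine measureReal_mono ?_
  rintro v ⟨⟨hv1, hv2⟩, hv3, hv4⟩
  have hv0 : v ≠ 0 := by
    rintro rfl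
    simp only [inner_zero_right] at hv1
    linarith
  have hvn : 0 < ‖v‖ := norm_pos_iff.2 hv0
  have hvle : ‖v‖ ≤ T + 1 + R := by
    calc ‖v‖ = ‖⟪q, v⟫ • q + (v - ⟪q, v⟫ • q)‖ := by congr 1; abel
      _ ≤ ‖⟪q, v⟫ • q‖ + ‖v - ⟪q, v⟫ • q‖ := norm_add_le _ _
      _ ≤ T + 1 + R := by
        refine add_le_add ?_ hv3
        rw [norm_smul, hq, mul_one, Real.norm_of_nonneg (hT.le.trans hv1)]
        exact hv2
  refine ⟨by rw [norm_smul, norm_inv, norm_norm, inv_mul_cancel₀ hvn.ne'], fun j hj => ?_⟩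
  rw [inner_smul_left, RCLike.conj_to_real, le_inv_mul_iff₀ hvn]
  have h1 := (abs_le.1 (hv4 j)).1
  rw [inner_sub_right, inner_smul_right, real_inner_comm v, real_inner_comm q] at h1
  have h2 : T * s ≤ ⟪q, v⟫ * ⟪q, a l - a j⟫ :=
    mul_le_mul hv1 (hs j hj) hs0 (hT.le.trans hv1)
  have h3 := mul_le_mul_of_nonneg_left hvle hg
  linarith

/-- The probability bound for the gap directions, with the parameters of the algorithm. -/
theorem rpow_le_randomUnit_gapDirections [FiniteDimensional ℝ E] [MeasurableSpace E]
    [BorelSpace E] {a : Fin k → E} {D δ c₀ : ℝ} (hk : 2 ≤ k) (hdim : Module.finrank ℝ E ≤ k)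
    (hc₀ : 100 ≤ c₀) (hδ0 : 0 < δ) (hδ1 : δ ≤ 1) (hδ : √(Real.log k) / √(c₀ * k) ≤ δ) (hD : 0 < D)
    (ha : ∀ i j, dist (a i) (a j) ≤ D) {l : Fin k} {q : E} (hq : ‖q‖ = 1)
    (hs : ∀ j, j ≠ l → 9 / 10 * δ * D ≤ ⟪q, a l - a j⟫) :
    (k : ℝ) ^ (-(105 / δ ^ 2)) ≤
      (randomUnit E).real (gapDirections a (2 / 5 * D / √(c₀ * k)) l) := by
  have hk2 : (2 : ℝ) ≤ k := by exact_mod_cast hk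
  have hk0 : (0 : ℝ) < k := by linarith
  have hlog2 := Real.log_two_gt_d9
  have hlog : Real.log 2 ≤ Real.log k := Real.log_le_log (by norm_num) hk2
  set L := √(Real.log k) with hL
  have hLsq : L ^ 2 = Real.log k := Real.sq_sqrt (by linarith)
  have hL8 : 4 / 5 ≤ L := Real.le_sqrt_of_sq_le (by linarith)
  set X := √(c₀ * k) with hX
  have hsk : 1 ≤ √(k : ℝ) := Real.one_le_sqrt.2 (by linarith)
  have hkX : √(k : ℝ) ≤ X / 10 := by
    rw [Real.sqrt_le_left (by positivity), div_pow, Real.sq_sqrt (by positivity)]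
    nlinarith
  have hX0 : 0 < X := by linarith
  -- The lower bound on `δ` keeps the component along `q` within order `√(c₀k)`, so that it does not
  -- inflate the norm.
  have hTX : L / δ ≤ X := by
    rw [div_le_iff₀ hX0] at hδ
    rw [div_le_iff₀ hδ0]
    linarith
  -- Here `T s = 9LD` and `lam D = 3LD` leave a gap `6LD` before normalization. The norm is at most
  -- `12X` and `L ≥ 4/5`, whence the gap `2/5 D / X`.
  refine le_trans ?_ (exp_le_randomUnit_gapDirections (s := 9 / 10 * δ * D) (T := 10 * (L / δ))
    (R := 2 * √(k : ℝ)) (lam := 3 * L) hD ha hq hs (by positivity) (by positivity) ?_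
    (by positivity) ?_ (by positivity) (by positivity) ?_)
  · rw [Real.rpow_def_of_pos hk0]
    have h2 : (2 : ℝ) = Real.exp (Real.log 2) := (Real.exp_log (by norm_num)).symm
    rw [h2, ← Real.exp_sub, ← h2]
    refine Real.exp_le_exp.2 ?_
    have hlog2' := Real.log_two_lt_d9
    have h3 : Real.log k * -(105 / δ ^ 2) = -(105 * (L / δ) ^ 2) := by
      rw [← hLsq]
      field_simp
    have h4 : L ≤ L / δ := le_div_self (by positivity) hδ0 hδ1
    have h5 : 69 / 100 ≤ (L / δ) ^ 2 := by
      have := pow_le_pow_left₀ (by positivity) h4 2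
      linarith
    rw [h3]
    -- With `t = L / δ`, the exponent `1 + (10t + 1)²/2 + log 2` is at most `100t² + 2 + log 2`; the
    -- constant part fits into `5t²` because `t² ≥ 69/100`. This is the origin of 105.
    nlinarith [sq_nonneg (10 * (L / δ) - 1)]
  · rw [mul_pow, Real.sq_sqrt hk0.le]
    have : (Module.finrank ℝ E : ℝ) ≤ k := by exact_mod_cast hdim
    linarith
  · have h1 : Real.exp (-(3 * L) ^ 2 / 2) ≤ ((k : ℝ) ^ 4)⁻¹ := by
      rw [← Real.exp_log (pow_pos hk0 4), ← Real.exp_neg, Real.log_pow]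
      refine Real.exp_le_exp.2 ?_
      push_cast
      nlinarith
    calc (k : ℝ) * (2 * Real.exp (-(3 * L) ^ 2 / 2)) ≤ k * (2 * ((k : ℝ) ^ 4)⁻¹) := by gcongr
      _ = 2 / (k : ℝ) ^ 3 := by field_simp
      _ ≤ 2 / 2 ^ 3 := by gcongr
      _ = 1 / 4 := by norm_num
  · have h1 : 10 * (L / δ) * (9 / 10 * δ * D) - 3 * L * D = 6 * L * D := by
      field_simp
      ring
    rw [h1, div_mul_eq_mul_div, div_le_iff₀ hX0]
    have h2 : 10 * (L / δ) + 1 + 2 * √(k : ℝ) ≤ 12 * X := by linarith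
    calc 2 / 5 * D * (10 * (L / δ) + 1 + 2 * √(k : ℝ)) ≤ 2 / 5 * D * (12 * X) := by gcongr
      _ = 6 * (4 / 5) * D * X := by ring
      _ ≤ 6 * L * D * X := by gcongr

end Queries

/-! ### The soft hull with the algorithm's parameters. -/

section Algorithm

variable {E : Type*} [NormedAddCommGroup E] [InnerProductSpace ℝ E] {k : ℕ}

theorem diam_convexHull_range_le {a : Fin k → E} {D : ℝ} (hD : 0 ≤ D)
    (ha : ∀ i j, dist (a i) (a j) ≤ D) : Metric.diam (convexHull ℝ (range a)) ≤ D := by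
  rw [convexHull_diam]
  refine Metric.diam_le_of_forall_dist_le hD ?_
  rintro _ ⟨i, rfl⟩ _ ⟨j, rfl⟩
  exact ha i j

theorem isBounded_convexHull_range (a : Fin k → E) :
    Bornology.IsBounded (convexHull ℝ (range a)) :=
  isBounded_convexHull.2 (finite_range a).isBounded

/-- The soft convex hull procedure with the parameters of the algorithm, on a finite set `W` near
the polytope that contains good approximations of its vertices. -/
theorem softHullOutput_spec_of_approx {a : Fin k → E} {D δ c₀ : ℝ} (hD : 0 < D)
    (hδ0 : 0 < δ) (hδ1 : δ ≤ 1) (hc₀ : 10 ^ 12 ≤ c₀)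
    (ha : ∀ i j, dist (a i) (a j) ≤ D) (hdiam : ∃ i j, 99 / 100 * D ≤ dist (a i) (a j))
    (hsep : ∀ l, ∃ q : E, ‖q‖ = 1 ∧ ∀ j, j ≠ l → 9 / 10 * δ * D ≤ ⟪q, a l - a j⟫)
    {W : Set E} (hWfin : W.Finite)
    (hWa : ∀ p ∈ W, ∃ y ∈ convexHull ℝ (range a), dist p y ≤ δ ^ 2 * D / (5 * √c₀))
    (hWv : ∀ l, ∃ p ∈ W, dist p (a l) ≤ δ ^ 2 * D / (5 * √c₀))
    {Q : Set E} (hQ : IsSoftHullOutput (32 * δ ^ 2 / √c₀) (4 * √(32 * δ ^ 2 / √c₀)) W Q) :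
    Q.ncard = k ∧ ∀ l, ∃ v' ∈ Q, dist v' (a l) ≤ δ * D / 6 := by
  have hc0 : 0 < c₀ := by linarith
  set y := √(√c₀) with hy
  have hysq : y ^ 2 = √c₀ := Real.sq_sqrt (Real.sqrt_nonneg _)
  have hy3 : 1000 ≤ y := by
    refine Real.le_sqrt_of_sq_le (Real.le_sqrt_of_sq_le ?_)
    linarith
  have hy0 : 0 < y := by linarith
  -- The small parameter is `z = c₀^(-1/4)`: both `ρ` and the tolerance are of order `δ²z²`, while
  -- `ε₃` is of order `δz`. Below, only `0 < z ≤ 1/1000` is used.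
  set z := y⁻¹ with hz
  have hz0 : 0 < z := inv_pos.2 hy0
  have hz1 : z ≤ 1 / 1000 := by
    rw [hz, one_div]
    exact inv_anti₀ (by norm_num) hy3
  have hρz : δ ^ 2 * D / (5 * √c₀) = δ ^ 2 * D * z ^ 2 / 5 := by
    rw [← hysq, hz]
    field_simp
  have hεz : 32 * δ ^ 2 / √c₀ = 32 * (δ ^ 2 * z ^ 2) := by
    rw [← hysq, hz]
    field_simp
  rw [hεz] at hQ
  rw [hρz] at hWa hWv
  clear_value z
  clear hεz hρz hz hy3 hy0 hysq hy hc0 hc₀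
  clear y c₀
  set ρ := δ ^ 2 * D * z ^ 2 / 5 with hρ
  have hδsq : δ ^ 2 * z ≤ δ / 1000 := by
    calc δ ^ 2 * z = δ * (δ * z) := by ring
      _ ≤ δ * (1 * (1 / 1000)) := by gcongr
      _ = δ / 1000 := by ring
  have hpos : 0 < δ * D * z := by positivity
  have hρD : ρ ≤ δ * D * z / 5000 := by
    have := mul_le_mul_of_nonneg_right hδsq (by positivity : 0 ≤ D * z)
    linarith
  have hδDz : δ * D * z ≤ δ * D / 1000 := by
    have := mul_le_mul_of_nonneg_left hz1 (by positivity : 0 ≤ δ * D)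
    linarith
  have hδD : δ * D ≤ D := mul_le_of_le_one_left hD.le hδ1
  have hδD0 : 0 < δ * D := by positivity
  have hL1 : 9 / 10 * D ≤ Metric.diam W := by
    obtain ⟨i, j, hij⟩ := hdiam
    obtain ⟨p, hp, hpa⟩ := hWv i
    obtain ⟨p', hp', hpa'⟩ := hWv j
    have h1 := Metric.dist_le_diam_of_mem hWfin.isBounded hp hp'
    have h2 := dist_triangle4 (a i) p p' (a j)
    rw [dist_comm (a i) p] at h2
    linarith
  have hL2 : Metric.diam W ≤ 11 / 10 * D := by
    refine Metric.diam_le_of_forall_dist_le (by positivity) fun p hp p' hp' => ?_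
    obtain ⟨b, hb, hpb⟩ := hWa p hp
    obtain ⟨b', hb', hpb'⟩ := hWa p' hp'
    have h1 := (Metric.dist_le_diam_of_mem (isBounded_convexHull_range a) hb hb').trans
      (diam_convexHull_range_le hD.le ha)
    have h2 := dist_triangle4 p b b' p'
    rw [dist_comm b' p'] at h2
    linarith
  -- The exact factor is `4√32`, about 22.6.
  have hε3a : 22 * (δ * z) ≤ 4 * √(32 * (δ ^ 2 * z ^ 2)) := by
    have : 11 / 2 * (δ * z) ≤ √(32 * (δ ^ 2 * z ^ 2)) := by
      refine Real.le_sqrt_of_sq_le ?_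
      rw [mul_pow, mul_pow]
      gcongr
      norm_num
    linarith
  have hε3b : 4 * √(32 * (δ ^ 2 * z ^ 2)) ≤ 23 * (δ * z) := by
    have : √(32 * (δ ^ 2 * z ^ 2)) ≤ 23 / 4 * (δ * z) := by
      rw [Real.sqrt_le_left (by positivity), mul_pow, mul_pow]
      gcongr
      norm_num
    linarith
  have hA : 22 * (δ * z) * (9 / 10 * D) ≤ 4 * √(32 * (δ ^ 2 * z ^ 2)) * Metric.diam W :=
    mul_le_mul hε3a hL1 (by positivity) (by positivity)
  have hB : 4 * √(32 * (δ ^ 2 * z ^ 2)) * Metric.diam W ≤ 23 * (δ * z) * (11 / 10 * D) :=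
    mul_le_mul hε3b hL2 (by linarith) (by positivity)
  set ε₃ := 4 * √(32 * (δ ^ 2 * z ^ 2))
  have hsepdist : ∀ i j, i ≠ j → 9 / 10 * δ * D ≤ dist (a i) (a j) := fun i j hij => by
    obtain ⟨q, hq, hqs⟩ := hsep i
    have h1 := real_inner_le_norm q (a i - a j)
    rw [hq, one_mul, ← dist_eq_norm] at h1
    exact (hqs j hij.symm).trans h1
  have hε1 : 2 * ρ ≤ 32 * (δ ^ 2 * z ^ 2) * Metric.diam W := by
    have := mul_le_mul_of_nonneg_left hL1 (by positivity : 0 ≤ 32 * (δ ^ 2 * z ^ 2))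
    have h2 : 0 ≤ δ ^ 2 * D * z ^ 2 := by positivity
    linarith
  -- The decisive comparison: order `δ²z²D` on the left, order `δ²zD` on the right.
  have hε2 : 32 * (δ ^ 2 * z ^ 2) * Metric.diam W <
      9 / 10 * δ * (ε₃ * Metric.diam W - 2 * ρ) - 2 * ρ := by
    have h1 := mul_le_mul_of_nonneg_left hL2 (by positivity : 0 ≤ 32 * (δ ^ 2 * z ^ 2))
    have h2 : 19 * (δ * D * z) ≤ ε₃ * Metric.diam W - 2 * ρ := by linarith
    have h3 := mul_le_mul_of_nonneg_left h2 (by positivity : 0 ≤ 9 / 10 * δ)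
    have h4 := mul_le_mul_of_nonneg_left hz1 (by positivity : 0 ≤ δ ^ 2 * D * z)
    have h5 : 0 < δ ^ 2 * D * z := by positivity
    linarith
  have hmain := softHullOutput_spec hWa hWv (by positivity : 0 ≤ 9 / 10 * δ) (fun l => ?_)
    hε1 hε2 (fun i j hij => by linarith [hsepdist i j hij]) (by linarith) hQ
  · refine ⟨hmain.1, fun l => ?_⟩
    obtain ⟨v', hv', hd⟩ := hmain.2 l
    exact ⟨v', hv', hd.trans (by linarith)⟩
  · obtain ⟨q, hq, hqs⟩ := hsep l
    refine ⟨q, hq.le, fun j => ?_⟩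
    rcases eq_or_ne j l with rfl | hj
    · simp
    · exact le_trans (mul_le_mul_of_nonneg_left (ha _ _) (by positivity)) (hqs j hj)

/-- If the oracle has a small absolute error and every vertex is the maximizer with a gap for one
of the queries, then every output of the algorithm consists of one point near each vertex. -/
theorem IsKOLPOutput.spec {a : Fin k → E} {D δ c₀ e : ℝ} (hk : 2 ≤ k) (hD : 0 < D)
    (hδ0 : 0 < δ) (hδ1 : δ ≤ 1) (hc₀ : 10 ^ 12 ≤ c₀) (he0 : 0 ≤ e)
    (he : e ≤ 3 / 100 * δ ^ 2 * D / (c₀ * √(k : ℝ)))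
    (ha : ∀ i j, dist (a i) (a j) ≤ D) (hdiam : ∃ i j, 99 / 100 * D ≤ dist (a i) (a j))
    (hsep : ∀ l, ∃ q : E, ‖q‖ = 1 ∧ ∀ j, j ≠ l → 9 / 10 * δ * D ≤ ⟪q, a l - a j⟫)
    {x : E → E} (hx : ∀ u : E, ‖u‖ = 1 → (∃ y ∈ convexHull ℝ (range a), dist (x u) y ≤ e) ∧
      ∀ y ∈ convexHull ℝ (range a), ⟪u, y⟫ - e ≤ ⟪u, x u⟫)
    {m : ℕ} {u : Fin m → E} (hu : ∀ i, ‖u i‖ = 1)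
    (hgap : ∀ l, ∃ i, u i ∈ gapDirections a (2 / 5 * D / √(c₀ * k)) l)
    {Q : Set E} (hQ : IsKOLPOutput δ c₀ x u Q) :
    Q.ncard = k ∧ ∀ l, ∃ v' ∈ Q, dist v' (a l) ≤ δ * D / 6 := by
  have hk2 : (2 : ℝ) ≤ k := by exact_mod_cast hk
  have hc0 : 0 < c₀ := by linarith
  set X := √c₀ with hX
  have hXsq : X ^ 2 = c₀ := Real.sq_sqrt hc0.le
  have hX1 : 100 ≤ X := Real.le_sqrt_of_sq_le (by linarith)
  have hX0 : 0 < X := by linarith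
  have hs1 : 1 ≤ √(k : ℝ) := Real.one_le_sqrt.2 (by linarith)
  have hs0 : 0 < √(k : ℝ) := by linarith
  have hρ0 : 0 ≤ δ ^ 2 * D := by positivity
  have he1 : e * (X * √(k : ℝ)) ≤ 3 / 100 * (δ ^ 2 * D / X) := by
    rw [← hXsq, le_div_iff₀ (by positivity)] at he
    rw [← mul_div_assoc, le_div_iff₀ hX0]
    linarith
  have he2 : e * 100 ≤ e * (X * √(k : ℝ)) := by
    gcongr
    nlinarith
  have hq : 0 ≤ δ ^ 2 * D / X := by positivity
  have hρX : δ ^ 2 * D / (5 * X) = δ ^ 2 * D / X / 5 := by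
    rw [div_div, mul_comm X 5]
  -- The noise bound makes this at most `15/100` of `δ²D/√c₀`, which leaves room for the extra `e`
  -- below the required `1/5`.
  have hg : 2 * e * D / (2 / 5 * D / √(c₀ * k)) = 5 * (e * (X * √(k : ℝ))) := by
    rw [Real.sqrt_mul hc0.le, ← hX]
    field_simp
  refine softHullOutput_spec_of_approx hD hδ0 hδ1 hc₀ ha hdiam hsep (finite_range _) ?_
    (fun l => ?_) hQ
  · rintro _ ⟨i, rfl⟩
    obtain ⟨y, hy, hxy⟩ := (hx (u i) (hu i)).1
    exact ⟨y, hy, hxy.trans (by rw [hρX]; linarith)⟩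
  · obtain ⟨i, hi⟩ := hgap l
    refine ⟨_, ⟨i, rfl⟩, (dist_le_of_mem_gapDirections hD (by positivity) ha hi (hx _ (hu i)).1
      (hx _ (hu i)).2).trans ?_⟩
    rw [hg, hρX]
    linarith

end Algorithm

/-! ### Separating directions and the geometry of the projected polytope. -/

section Geometry

variable {d n k : ℕ}

theorem finrank_le_of_isSVDSubspace {A : Matrix (Fin d) (Fin n) ℝ}
    {V : Submodule ℝ (EuclideanSpace ℝ (Fin d))} (hV : IsSVDSubspace A k V) :
    Module.finrank ℝ V ≤ k := by
  obtain ⟨hkd, b, s, -, -, -, rfl⟩ := hV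
  have : b '' {i : Fin d | (i : ℕ) < k} = range fun i : Fin k => b (Fin.castLE hkd i) := by
    ext v
    constructor
    · rintro ⟨i, hi, rfl⟩
      exact ⟨⟨i, hi⟩, rfl⟩
    · rintro ⟨i, rfl⟩
      exact ⟨Fin.castLE hkd i, i.2, rfl⟩
  rw [this]
  simpa [Set.finrank] using finrank_range_le_card (R := ℝ) fun i : Fin k => b (Fin.castLE hkd i)

/-- The direction from the nearest point `b` of `C` to `v` works: the variational inequality at `b`
keeps `C` behind the supporting hyperplane. -/
theorem exists_separating_of_forall_le_dist {E : Type*} [NormedAddCommGroup E]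
    [InnerProductSpace ℝ E] {C : Set E} (hC : IsComplete C) (hconv : Convex ℝ C)
    (hne : C.Nonempty) {v : E} {s : ℝ} (hs : 0 < s) (h : ∀ y ∈ C, s ≤ dist v y) :
    ∃ q : E, ‖q‖ = 1 ∧ ∀ y ∈ C, s ≤ ⟪q, v - y⟫ := by
  obtain ⟨b, hb, hmin⟩ := exists_norm_eq_iInf_of_complete_convex hne hC hconv v
  have hin := (norm_eq_iInf_iff_real_inner_le_zero hconv hb).1 hmin
  have hsb : s ≤ ‖v - b‖ := by rw [← dist_eq_norm]; exact h b hb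
  have hpos : 0 < ‖v - b‖ := hs.trans_le hsb
  refine ⟨‖v - b‖⁻¹ • (v - b), by rw [norm_smul, norm_inv, norm_norm, inv_mul_cancel₀ hpos.ne'],
    fun y hy => hsb.trans ?_⟩
  rw [real_inner_smul_left, le_inv_mul_iff₀ hpos]
  have h1 : v - y = (v - b) - (y - b) := by abel
  rw [h1, inner_sub_right, real_inner_self_eq_norm_mul_norm]
  linarith [hin y hy]

theorem WellSeparated.exists_separating {E : Type*} [NormedAddCommGroup E]
    [InnerProductSpace ℝ E] {K : Set E} {M : Fin k → E} (hk : 2 ≤ k)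
    (hK : IsPolytopeWithVertices K M) {δ : ℝ} (hδ : 0 < δ * Metric.diam K)
    (hsep : WellSeparated δ K) (l : Fin k) :
    ∃ q : E, ‖q‖ = 1 ∧ ∀ j, j ≠ l → δ * Metric.diam K ≤ ⟪q, M l - M j⟫ := by
  have hfin : (range M \ {M l}).Finite := (finite_range M).subset sdiff_subset
  have hmem : ∀ j, j ≠ l → M j ∈ range M \ {M l} := fun j hj =>
    ⟨mem_range_self j, fun h => hj (hK.injective h)⟩
  have : Nontrivial (Fin k) := Fin.nontrivial_iff_two_le.2 hk
  obtain ⟨j, hj⟩ := exists_ne l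
  obtain ⟨q, hq, hqs⟩ := exists_separating_of_forall_le_dist
    (hfin.isCompact_convexHull ℝ).isComplete (convex_convexHull ℝ _)
    ⟨M j, subset_convexHull ℝ _ (hmem j hj)⟩ (v := M l) hδ (fun y hy => by
      refine hsep (M l) ?_ y ?_
      · rw [hK.extremePoints_eq]
        exact mem_range_self l
      · rw [hK.extremePoints_eq]
        exact hy)
  exact ⟨q, hq, fun j hj => hqs _ (subset_convexHull ℝ _ (hmem j hj))⟩

theorem projSet_convexHull (V : Submodule ℝ (EuclideanSpace ℝ (Fin d)))
    (M : Fin k → EuclideanSpace ℝ (Fin d)) :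
    projSet V (convexHull ℝ (range M)) =
      convexHull ℝ (range fun l => V.orthogonalProjectionOnto (M l)) := by
  have h := (V.orthogonalProjectionOnto.toLinearMap).image_convexHull (range M)
  rw [← range_comp] at h
  exact h

theorem exists_dist_eq_diam_convexHull {E : Type*} [NormedAddCommGroup E] [NormedSpace ℝ E]
    (hk : 0 < k) (M : Fin k → E) :
    ∃ i j, dist (M i) (M j) = Metric.diam (convexHull ℝ (range M)) := by
  have : Nonempty (Fin k) := ⟨⟨0, hk⟩⟩
  rw [convexHull_diam]
  obtain ⟨⟨i, j⟩, -, hmax⟩ := Finset.exists_max_image Finset.univ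
    (fun p : Fin k × Fin k => dist (M p.1) (M p.2)) Finset.univ_nonempty
  refine ⟨i, j, le_antisymm (Metric.dist_le_diam_of_mem (finite_range M).isBounded
    (mem_range_self i) (mem_range_self j))
    (Metric.diam_le_of_forall_dist_le dist_nonneg ?_)⟩
  rintro _ ⟨i', rfl⟩ _ ⟨j', rfl⟩
  exact hmax (i', j') (Finset.mem_univ _)

theorem dist_self_orthogonalProjectionOnto (V : Submodule ℝ (EuclideanSpace ℝ (Fin d)))
    (v : EuclideanSpace ℝ (Fin d)) :
    dist v (V.orthogonalProjectionOnto v) = ‖Vᗮ.starProjection v‖ := by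
  rw [dist_eq_norm, Submodule.starProjection_orthogonal_val]
  rfl

end Geometry

/-! ### Stability of distances and separation under projection to `V`. -/

section Projection

variable {d k : ℕ}

theorem dist_sub_le_dist_orthogonalProjectionOnto
    (V : Submodule ℝ (EuclideanSpace ℝ (Fin d))) {v v' : EuclideanSpace ℝ (Fin d)} {t : ℝ}
    (hv : ‖Vᗮ.starProjection v‖ ≤ t) (hv' : ‖Vᗮ.starProjection v'‖ ≤ t) :
    dist v v' - 2 * t ≤ dist (V.orthogonalProjectionOnto v) (V.orthogonalProjectionOnto v') := by
  have h := dist_triangle4 v (V.orthogonalProjectionOnto v) (V.orthogonalProjectionOnto v') v'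
  rw [dist_self_orthogonalProjectionOnto, dist_comm (V.orthogonalProjectionOnto v' : EuclideanSpace ℝ (Fin d)) v',
    dist_self_orthogonalProjectionOnto, ← Subtype.dist_eq] at h
  linarith

theorem dist_orthogonalProjectionOnto_le (V : Submodule ℝ (EuclideanSpace ℝ (Fin d)))
    (v v' : EuclideanSpace ℝ (Fin d)) :
    dist (V.orthogonalProjectionOnto v) (V.orthogonalProjectionOnto v') ≤ dist v v' := by
  rw [dist_eq_norm, dist_eq_norm, ← map_sub]
  exact V.norm_orthogonalProjectionOnto_apply_le _

/-- Separation of a vertex from the other vertices survives the projection to a subspace that is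
close to all vertices. -/
theorem exists_separating_orthogonalProjectionOnto
    {V : Submodule ℝ (EuclideanSpace ℝ (Fin d))} {M : Fin k → EuclideanSpace ℝ (Fin d)} {t s : ℝ}
    (hk : 2 ≤ k) (hM : ∀ l, ‖Vᗮ.starProjection (M l)‖ ≤ t) (hs : 2 * t < s) {l : Fin k}
    {q : EuclideanSpace ℝ (Fin d)} (hq : ‖q‖ = 1) (hqs : ∀ j, j ≠ l → s ≤ ⟪q, M l - M j⟫) :
    ∃ q' : V, ‖q'‖ = 1 ∧ ∀ j, j ≠ l →
      s - 2 * t ≤ ⟪q', V.orthogonalProjectionOnto (M l) - V.orthogonalProjectionOnto (M j)⟫ := by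
  have hp1 : ‖V.orthogonalProjectionOnto q‖ ≤ 1 :=
    hq ▸ V.norm_orthogonalProjectionOnto_apply_le q
  have key : ∀ j, j ≠ l → s - 2 * t ≤ ⟪V.orthogonalProjectionOnto q,
      V.orthogonalProjectionOnto (M l) - V.orthogonalProjectionOnto (M j)⟫ := fun j hj => by
    -- Projecting both vectors loses only the pairing of `q` with the `Vᗮ`-part of `M l - M j`,
    -- which is at most `2t`.
    have h1 : ⟪V.orthogonalProjectionOnto q,
        V.orthogonalProjectionOnto (M l) - V.orthogonalProjectionOnto (M j)⟫ =
        ⟪q, M l - M j⟫ - ⟪q, Vᗮ.starProjection (M l - M j)⟫ := by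
      rw [← map_sub, Submodule.starProjection_orthogonal_val, inner_sub_right,
        Submodule.inner_orthogonalProjectionOnto_eq_of_mem_right]
      simp only [map_sub, inner_sub_right, AddSubgroupClass.coe_sub,
        Submodule.starProjection_apply]
      ring
    have h2 := real_inner_le_norm q (Vᗮ.starProjection (M l - M j))
    rw [hq, one_mul, map_sub] at h2
    have h3 := norm_sub_le (Vᗮ.starProjection (M l)) (Vᗮ.starProjection (M j))
    rw [h1, map_sub]
    linarith [hM l, hM j, hqs j hj]
  have : Nontrivial (Fin k) := Fin.nontrivial_iff_two_le.2 hk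
  obtain ⟨j, hj⟩ := exists_ne l
  have hpos : 0 < ‖V.orthogonalProjectionOnto q‖ := by
    refine norm_pos_iff.2 fun h0 => ?_
    have := key j hj
    rw [h0, inner_zero_left] at this
    linarith
  refine ⟨‖V.orthogonalProjectionOnto q‖⁻¹ • V.orthogonalProjectionOnto q,
    by rw [norm_smul, norm_inv, norm_norm, inv_mul_cancel₀ hpos.ne'], fun j hj => ?_⟩
  have h1 := real_inner_smul_left (V.orthogonalProjectionOnto q)
    (V.orthogonalProjectionOnto (M l) - V.orthogonalProjectionOnto (M j))
    ‖V.orthogonalProjectionOnto q‖⁻¹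
  refine le_trans ?_ h1.ge
  rw [le_inv_mul_iff₀ hpos]
  refine le_trans ?_ (key j hj)
  -- The projected `q` has norm at most 1 and the bound is positive, so renormalizing can only help.
  exact mul_le_of_le_one_left (by linarith) hp1

end Projection

end LatentPolytope

/-! ### Assembly of the main theorem. -/

open LatentPolytope in
theorem mainTheorem11 :
    ∃ C₀ C : ℝ, 0 < C₀ ∧ 0 < C ∧
      ∀ (c₀ : ℝ), C₀ ≤ c₀ →
      ∀ (d n k : ℕ), 2 ≤ k → 0 < n →
      ∀ (K : Set (EuclideanSpace ℝ (Fin d))) (M : Fin k → EuclideanSpace ℝ (Fin d))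
        (P A : Matrix (Fin d) (Fin n) ℝ) (w₀ δ : ℝ),
        LatentPolytope.IsPolytopeWithVertices K M →
        (∀ j, LatentPolytope.col P j ∈ K) →
        0 < w₀ →
        (∀ l : Fin k, w₀ * n ≤
          ({j : Fin n | ‖LatentPolytope.col P j - M l‖ ≤
            LatentPolytope.sigma0 P A / √w₀}.ncard : ℝ)) →
        √(Real.log k) / √(c₀ * k) ≤ δ → δ ≤ 1 →
        LatentPolytope.WellSeparated δ K →
        LatentPolytope.sigma0 P A ≤ δ ^ 2 * Metric.diam K / (100 * c₀) * (√w₀ / √(k : ℝ)) →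
      ∀ V : Submodule ℝ (EuclideanSpace ℝ (Fin d)), LatentPolytope.IsSVDSubspace A k V →
      ∀ r : ℕ, w₀ * n / 2 ≤ r → r ≤ ⌈w₀ * n⌉₊ →
        (∃ x : V → V, LatentPolytope.IsSubsetSmoothing A V r x) ∧
        ∀ x : V → V, LatentPolytope.IsSubsetSmoothing A V r x →
          LatentPolytope.IsOptOracle
            (10 * LatentPolytope.sigma0 P A / (√w₀ * Metric.diam K))
            (LatentPolytope.projSet V K) x ∧
          ∀ η : ℝ, 0 < η → η < 1 →
          ∀ m : ℕ, (k : ℝ) ^ (C / δ ^ 2) * Real.log (k / η) ≤ m →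
            MeasureTheory.Measure.pi (fun _ : Fin m => LatentPolytope.randomUnit V)
              {u : Fin m → V |
                ¬ ((∃ Q : Set V, LatentPolytope.IsKOLPOutput δ c₀ x u Q) ∧
                  ∀ Q : Set V, LatentPolytope.IsKOLPOutput δ c₀ x u Q →
                    Q ⊆ Set.range (fun i => x (u i)) ∧ Q.ncard = k ∧
                    ∀ v ∈ K.extremePoints ℝ, ∃ v' ∈ Q,
                      ‖v - (v' : EuclideanSpace ℝ (Fin d))‖ ≤ δ * Metric.diam K / 5)}
              ≤ ENNReal.ofReal η := by
  -- `10 ^ 12` ensures `c₀^(-1/4) ≤ 1/1000`; 105 is the exponent from the Gaussian estimate.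
  refine ⟨10 ^ 12, 105, by norm_num, by norm_num, ?_⟩
  intro c₀ hc₀ d n k hk hn K M P A w₀ δ hK hP hw₀ hcount hδ hδ1 hsep hσ V hV r hr hr'
  have hk2 : (2 : ℝ) ≤ k := by exact_mod_cast hk
  have hn' : (0 : ℝ) < n := by exact_mod_cast hn
  have hc0 : 0 < c₀ := by linarith
  have hKconv := hK.eq_convexHull
  have hδ0 : 0 < δ := by
    refine lt_of_lt_of_le ?_ hδ
    have : 0 < Real.log k := Real.log_pos (by linarith)
    positivity
  have hDeq : ∃ i j, dist (M i) (M j) = Metric.diam K := by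
    rw [hKconv]
    exact exists_dist_eq_diam_convexHull (by omega) M
  have hMD : ∀ i j, dist (M i) (M j) ≤ Metric.diam K := fun i j => by
    rw [hKconv]
    exact Metric.dist_le_diam_of_mem (isBounded_convexHull_range M)
      (subset_convexHull ℝ _ (mem_range_self i)) (subset_convexHull ℝ _ (mem_range_self j))
  have : Nontrivial (Fin k) := Fin.nontrivial_iff_two_le.2 hk
  have hD : 0 < Metric.diam K := by
    obtain ⟨i, j, hij⟩ := exists_pair_ne (Fin k)
    exact (dist_pos.2 (hK.injective.ne hij)).trans_le (hMD i j)
  set D := Metric.diam K with hDdef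
  let S : Fin k → Finset (Fin n) := fun l =>
    (Set.toFinite {j : Fin n | ‖col P j - M l‖ ≤ sigma0 P A / √w₀}).toFinset
  have hS : ∀ l, w₀ * n ≤ (S l).card := fun l => by
    have := hcount l
    rwa [Set.ncard_eq_toFinset_card] at this
  have hSl : ∀ l, ∀ j ∈ S l, ‖col P j - M l‖ ≤ sigma0 P A / √w₀ := fun l j hj => by
    simpa [S] using hj
  have hrn : r ≤ n := by
    obtain ⟨l⟩ : Nonempty (Fin k) := inferInstance
    refine (hr'.trans (Nat.ceil_le.2 (hS l))).trans ?_
    simpa using Finset.card_le_univ (S l)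
  refine ⟨exists_isSubsetSmoothing A V hrn, fun x hx => ?_⟩
  have hora : ∀ u : V, ‖u‖ = 1 → _ := fun u hu =>
    hx.oracle hn hw₀ hKconv hP hS hSl hr hr' (u := u) hu
  have hvert := fun l =>
    norm_starProjection_orthogonal_vertex_le hn hw₀ hKconv hP hV (hS l) (hSl l)
  have hsw : 0 < √w₀ := Real.sqrt_pos.2 hw₀
  have hsk : 1 ≤ √(k : ℝ) := Real.one_le_sqrt.2 (by linarith)
  have he0 : 0 ≤ 3 * (sigma0 P A / √w₀) :=
    mul_nonneg (by norm_num) (div_nonneg (sigma0_nonneg _ _) hsw.le)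
  have hquot : 10 * sigma0 P A / (√w₀ * D) = 10 / 3 * (3 * (sigma0 P A / √w₀)) / D := by
    field_simp
  have he : 3 * (sigma0 P A / √w₀) ≤ 3 / 100 * δ ^ 2 * D / (c₀ * √(k : ℝ)) := by
    have h1 : sigma0 P A / √w₀ ≤ δ ^ 2 * D / (100 * c₀) / √(k : ℝ) := by
      rw [div_le_iff₀ hsw]
      refine hσ.trans (le_of_eq ?_)
      ring
    refine (mul_le_mul_of_nonneg_left h1 (by norm_num)).trans (le_of_eq ?_)
    field_simp
  set e := 3 * (sigma0 P A / √w₀) with hedef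
  have he' : e ≤ δ * D / 1000 := by
    refine he.trans ?_
    rw [div_le_iff₀ (by positivity)]
    have h1 : 1000 ≤ c₀ * √(k : ℝ) := by nlinarith
    have h2 : δ ^ 2 ≤ δ := by nlinarith
    calc 3 / 100 * δ ^ 2 * D ≤ 3 / 100 * δ * D := by gcongr
      _ ≤ δ * D / 1000 * 1000 := by nlinarith [mul_pos hδ0 hD]
      _ ≤ _ := by gcongr
  have hδD : δ * D ≤ D := mul_le_of_le_one_left hD.le hδ1
  set a : Fin k → V := fun l => V.orthogonalProjectionOnto (M l) with hadef
  have hhull : projSet V K = convexHull ℝ (range a) := by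
    rw [hKconv]
    exact projSet_convexHull V M
  have ha : ∀ i j, dist (a i) (a j) ≤ D := fun i j =>
    (dist_orthogonalProjectionOnto_le V _ _).trans (hMD i j)
  have hdiam : ∃ i j, 99 / 100 * D ≤ dist (a i) (a j) := by
    obtain ⟨i, j, hij⟩ := hDeq
    refine ⟨i, j, le_trans ?_
      (dist_sub_le_dist_orthogonalProjectionOnto V (hvert i) (hvert j))⟩
    rw [hij]
    linarith
  have hsepV : ∀ l, ∃ q : V, ‖q‖ = 1 ∧ ∀ j, j ≠ l → 9 / 10 * δ * D ≤ ⟪q, a l - a j⟫ := by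
    intro l
    obtain ⟨q, hq, hqs⟩ := hsep.exists_separating hk hK (mul_pos hδ0 hD) l
    have hδD0 : 0 < δ * D := mul_pos hδ0 hD
    obtain ⟨q', hq', hqs'⟩ := exists_separating_orthogonalProjectionOnto hk hvert
      (by linarith) hq hqs
    exact ⟨q', hq', fun j hj => le_trans (by linarith) (hqs' j hj)⟩
  refine ⟨?_, fun η hη0 hη1 m hm => ?_⟩
  -- The oracle error is relative to the diameter of the projection, which is at least `99/100 D`;
  -- the factor 10 in place of 3 more than covers the loss.
  · have hle : e ≤ 10 * sigma0 P A / (√w₀ * D) * Metric.diam (projSet V K) := by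
      obtain ⟨i, j, hij⟩ := hdiam
      have h1 : 99 / 100 * D ≤ Metric.diam (projSet V K) := by
        rw [hhull]
        exact hij.trans (Metric.dist_le_diam_of_mem (isBounded_convexHull_range a)
          (subset_convexHull ℝ _ (mem_range_self i)) (subset_convexHull ℝ _ (mem_range_self j)))
      rw [hquot, div_mul_eq_mul_div, le_div_iff₀ hD]
      calc e * D ≤ 10 / 3 * e * (99 / 100 * D) := by
            have := mul_nonneg he0 hD.le
            linarith
        _ ≤ _ := by gcongr
    intro u hu
    obtain ⟨⟨y, hy, hyd⟩, h2⟩ := hora u hu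
    exact ⟨⟨y, hy, hyd.trans hle⟩, fun y hy => (sub_le_sub_left hle _).trans (h2 y hy)⟩
  · have hnt : Nontrivial V := by
      obtain ⟨i, j, hij⟩ := hdiam
      refine ⟨a i, a j, fun h => ?_⟩
      rw [h, dist_self] at hij
      linarith
    have hprob := isProbabilityMeasure_randomUnit V
    have hp : ∀ l, (k : ℝ) ^ (-(105 / δ ^ 2)) ≤
        (randomUnit V).real (gapDirections a (2 / 5 * D / √(c₀ * k)) l) := fun l => by
      obtain ⟨q, hq, hqs⟩ := hsepV l
      exact rpow_le_randomUnit_gapDirections hk (finrank_le_of_isSVDSubspace hV) (by linarith)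
        hδ0 hδ1 hδ hD ha hq hqs
    have hk0 : (0 : ℝ) < k := by linarith
    have hbad := pi_forall_notMem_le (randomUnit V) (m := m) (η := η) (by omega : 0 < k)
      (fun l => measurableSet_gapDirections a (2 / 5 * D / √(c₀ * k)) l) hp hη0 (by
        rw [Real.rpow_neg hk0.le, le_inv_mul_iff₀ (by positivity)]
        exact hm)
    have hunit : ∀ᵐ u ∂(Measure.pi fun _ : Fin m => randomUnit V), ∀ i, ‖u i‖ = 1 :=
      ae_all_iff.2 fun i => (Measure.quasiMeasurePreserving_eval
        (fun _ : Fin m => randomUnit V) i).ae ae_norm_eq_one_randomUnit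
    -- The oracle `x` is arbitrary, so the failure event need not be measurable. It suffices that,
    -- up to a null set, it lies in the event that some vertex is missed, which no longer involves
    -- `x`.
    refine le_trans (measure_mono_ae ?_) hbad
    filter_upwards [hunit] with u hu hfail
    by_contra hgood
    refine hfail ⟨exists_isSoftHullOutput (finite_range _), fun Q hQ => ?_⟩
    have hgap : ∀ l, ∃ i, u i ∈ gapDirections a (2 / 5 * D / √(c₀ * k)) l := by
      intro l
      by_contra! h
      exact hgood ⟨l, h⟩
    have hspec := hQ.spec hk hD hδ0 hδ1 hc₀ he0 he ha hdiam hsepV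
      (fun u hu => by rw [← hhull]; exact hora u hu) hu hgap
    refine ⟨subset_of_isSoftHullOutput hQ, hspec.1, fun v hv => ?_⟩
    rw [hK.extremePoints_eq] at hv
    obtain ⟨l, rfl⟩ := hv
    obtain ⟨v', hv', hd⟩ := hspec.2 l
    refine ⟨v', hv', ?_⟩
    -- The final `δD/5` is `δD/6` inside `V` plus the distance from `M l` to `V`, at most `e ≤
    -- δD/1000`.
    have h1 := dist_triangle (M l) (a l : EuclideanSpace ℝ (Fin d)) v'
    rw [dist_self_orthogonalProjectionOnto, ← Subtype.dist_eq, dist_comm (a l), dist_eq_norm] at h1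
    linarith [hvert l, mul_pos hδ0 hD]
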